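/- A cardinal $\kappa$ is an $\omega$-Erdős cardinal if $\kappa\to(\omega)^{<\omega}_2$, i.e. for every $f:[\kappa]^{<\omega}\to 2$ there is $H\subseteq\kappa$ of order type $\omega$ such that, for each $n<\omega$, $f$ is constant on $[H]^n$. A cardinal $\kappa$ is extremely reflective if for every set $a$ there are an ordinal $\lambda<\kappa$, transitive sets $M,N$ that are models of ZFC with $V_\lambda\cup\{V_\lambda\}\subseteq M$ and $a\in N$, and an elementary embedding $j:M\to N$ with critical point $\lambda$ and $j(\lambda)=\kappa$. Theorem. (In ZFC.) Suppose that there is an $\omega$-Erdős cardinal and let $\kappa(\omega)$ be the least one. Then $V_{\kappa(\omega)}$ is a model of ZFC together with "there is a proper class of extremely reflective cardinals". (This is how the theory ZFC + "there is a proper class of extremely reflective cardinals" is interpreted in ZFC + "there is an $\omega$-Erdős cardinal".) Moreover, the set of cardinals below $\kappa(\omega)$ that are extremely reflective in the sense of $V_{\kappa(\omega)}$ is a stationary subset of $\kappa(\omega)$. -/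

import Mathlib

open FirstOrder FirstOrder.Language
open scoped ZFSet

universe u

namespace SetTheoryLang

/-! ### The first-order language of set theory and the theory ZFC -/

/-- The relation symbols of the language of set theory: one binary symbol `∈`. -/
inductive MemRel : ℕ → Type
  | mem : MemRel 2

/-- The first-order language of set theory (equality is a logical symbol). -/
def setLang : FirstOrder.Language.{0, 0} := ⟨fun _ => Empty, MemRel⟩

/-- A set or class of sets, given by a predicate, is a structure for the language of set theory
under the true membership relation. -/
instance memStructure (p : ZFSet.{u} → Prop) : setLang.Structure (Subtype p) where
  funMap := fun f => f.elim
  RelMap := fun {_} r =>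
    match r with
    | MemRel.mem => fun v => (v 0).1 ∈ (v 1).1

/-- The atomic formula `x_i ∈ x_j`. -/
def memF (n : ℕ) (i j : Fin n) : setLang.BoundedFormula Empty n :=
  Relations.boundedFormula₂ (L := setLang) MemRel.mem (&i) (&j)

/-- The atomic formula `x_i = x_j`. -/
def eqF (n : ℕ) (i j : Fin n) : setLang.BoundedFormula Empty n :=
  Term.bdEqual (L := setLang) (&i) (&j)

/-
In the sentences below the quantifier that stands under `n` other quantifiers binds the variable
number `n`. The matrix of each sentence is repeated in words.
-/

/-- Extensionality: `∀ x₀ x₁, (∀ x₂, x₂ ∈ x₀ ↔ x₂ ∈ x₁) → x₀ = x₁`. -/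
def axExtensionality : setLang.Sentence :=
  ∀' ∀' ((∀' (memF 3 2 0 ⇔ memF 3 2 1)) ⟹ eqF 2 0 1)

/-- Foundation: `∀ x₀, (∃ x₁, x₁ ∈ x₀) → ∃ x₁, x₁ ∈ x₀ ∧ ∀ x₂, x₂ ∈ x₁ → x₂ ∉ x₀`. -/
def axFoundation : setLang.Sentence :=
  ∀' ((∃' memF 2 1 0) ⟹
    ∃' (memF 2 1 0 ⊓ ∀' (memF 3 2 1 ⟹ ∼(memF 3 2 0))))

/-- Pairing: `∀ x₀ x₁, ∃ x₂, ∀ x₃, x₃ ∈ x₂ ↔ x₃ = x₀ ∨ x₃ = x₁`. -/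
def axPairing : setLang.Sentence :=
  ∀' ∀' ∃' ∀' (memF 4 3 2 ⇔ (eqF 4 3 0 ⊔ eqF 4 3 1))

/-- Union: `∀ x₀, ∃ x₁, ∀ x₂, x₂ ∈ x₁ ↔ ∃ x₃, x₃ ∈ x₀ ∧ x₂ ∈ x₃`. -/
def axUnion : setLang.Sentence :=
  ∀' ∃' ∀' (memF 3 2 1 ⇔ ∃' (memF 4 3 0 ⊓ memF 4 2 3))

/-- Power set: `∀ x₀, ∃ x₁, ∀ x₂, x₂ ∈ x₁ ↔ ∀ x₃, x₃ ∈ x₂ → x₃ ∈ x₀`. -/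
def axPowerSet : setLang.Sentence :=
  ∀' ∃' ∀' (memF 3 2 1 ⇔ ∀' (memF 4 3 2 ⟹ memF 4 3 0))

/-- Infinity: there is `x₀` with `∃ x₁ ∈ x₀, ∀ x₂, x₂ ∉ x₁` and
`∀ x₁ ∈ x₀, ∃ x₂ ∈ x₀, ∀ x₃, x₃ ∈ x₂ ↔ x₃ ∈ x₁ ∨ x₃ = x₁`. -/
def axInfinity : setLang.Sentence :=
  ∃' ((∃' (memF 2 1 0 ⊓ ∀' ∼(memF 3 2 1))) ⊓
    ∀' (memF 2 1 0 ⟹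
      ∃' (memF 3 2 0 ⊓ ∀' (memF 4 3 2 ⇔ (memF 4 3 1 ⊔ eqF 4 3 1)))))

/-- Choice: every set `x₀` of nonempty, pairwise disjoint sets has a transversal, i.e. if
`∀ x₁ ∈ x₀, ∃ x₂, x₂ ∈ x₁` and
`∀ x₁ x₂, x₁ ∈ x₀ → x₂ ∈ x₀ → (∃ x₃, x₃ ∈ x₁ ∧ x₃ ∈ x₂) → x₁ = x₂`, then
`∃ x₁, ∀ x₂ ∈ x₀, ∃ x₃, ∀ x₄, (x₄ ∈ x₂ ∧ x₄ ∈ x₁) ↔ x₄ = x₃`. -/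
def axChoice : setLang.Sentence :=
  ∀' ((∀' (memF 2 1 0 ⟹ ∃' memF 3 2 1)) ⟹
    ((∀' ∀' (memF 3 1 0 ⟹ (memF 3 2 0 ⟹
      ((∃' (memF 4 3 1 ⊓ memF 4 3 2)) ⟹ eqF 3 1 2)))) ⟹
    ∃' ∀' (memF 3 2 0 ⟹
      ∃' ∀' ((memF 5 4 2 ⊓ memF 5 4 1) ⇔ eqF 5 4 3))))

/-- Separation for `φ(p, x)`, with parameters `p = (p₀, …, p_{n-1})`:
`∀ p a, ∃ b, ∀ x, x ∈ b ↔ x ∈ a ∧ φ(p, x)`. The variables `a`, `b`, `x` have the numbers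
`n`, `n + 1`, `n + 2`. -/
def axSeparation (n : ℕ) (φ : setLang.Formula (Fin n ⊕ Fin 1)) : setLang.Sentence :=
  let b : Fin (n + 3) := Fin.natAdd n 1
  let x : Fin (n + 3) := Fin.natAdd n 2
  BoundedFormula.alls (n := n + 1) <|
    ∃' ∀' (memF (n + 3) x b ⇔ (memF (n + 3) x (Fin.natAdd n 0) ⊓
      BoundedFormula.relabel (n := n + 3) (k := 0)
        (Sum.inr ∘ Sum.elim (Fin.castAdd 3) ![x]) φ))

/-- Replacement for `φ(p, x, y)`, with parameters `p = (p₀, …, p_{n-1})`: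
`∀ p a, (∀ x y z, x ∈ a → φ(p, x, y) → φ(p, x, z) → y = z) →
  ∃ b, ∀ y, y ∈ b ↔ ∃ x, x ∈ a ∧ φ(p, x, y)`.
The variable `a` has the number `n`; in the premise `x`, `y`, `z` have the numbers
`n + 1`, `n + 2`, `n + 3`; in the conclusion `b`, `y`, `x` have these numbers. -/
def axReplacement (n : ℕ) (φ : setLang.Formula (Fin n ⊕ Fin 2)) : setLang.Sentence :=
  let a : Fin (n + 4) := Fin.natAdd n 0
  let v₁ : Fin (n + 4) := Fin.natAdd n 1
  let v₂ : Fin (n + 4) := Fin.natAdd n 2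
  let v₃ : Fin (n + 4) := Fin.natAdd n 3
  let sub (s t : Fin (n + 4)) : setLang.BoundedFormula Empty (n + 4) :=
    BoundedFormula.relabel (n := n + 4) (k := 0)
      (Sum.inr ∘ Sum.elim (Fin.castAdd 4) ![s, t]) φ
  BoundedFormula.alls (n := n + 1) <|
    (∀' ∀' ∀' (memF (n + 4) v₁ a ⟹ (sub v₁ v₂ ⟹ (sub v₁ v₃ ⟹ eqF (n + 4) v₂ v₃)))) ⟹
      ∃' ∀' (memF (n + 3) (Fin.natAdd n 2) (Fin.natAdd n 1) ⇔
        ∃' (memF (n + 4) v₃ a ⊓ sub v₃ v₂))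

/-- The first-order theory ZFC. -/
def ZFC : setLang.Theory :=
  {axExtensionality, axFoundation, axPairing, axUnion, axPowerSet, axInfinity, axChoice} ∪
    {σ | ∃ n φ, σ = axSeparation n φ} ∪ {σ | ∃ n φ, σ = axReplacement n φ}

/-! ### Erdős cardinals -/

/-- `κ` is an `ω`-Erdős cardinal: `κ → (ω)^{<ω}₂`. Every colouring of the finite subsets of `κ`
with two colours has a homogeneous set `H ⊆ κ` of order type `ω`, i.e. finite subsets of `H` with
the same number of elements have the same colour. -/
def IsOmegaErdos (κ : Cardinal.{u}) : Prop :=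
  ∀ f : Finset (Set.Iio κ.ord) → Bool, ∃ H : Set (Set.Iio κ.ord), Nonempty (ℕ ≃o H) ∧
    ∀ s t : Finset (Set.Iio κ.ord), (s : Set (Set.Iio κ.ord)) ⊆ H →
      (t : Set (Set.Iio κ.ord)) ⊆ H → s.card = t.card → f s = f t

/-! ### Extremely reflective cardinals -/

/-- The ordinal `lam` is the critical point of `j : M → N`: it is the least ordinal moved by `j`
(`M` is transitive where this is used, so the elements of `lam` are elements of `M`). -/
def IsCriticalPoint {M N : ZFSet.{u}} (j : M → N) (lam : Ordinal.{u}) : Prop :=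
  (∀ x : M, x.1 ∈ lam.toZFSet → (j x).1 = x.1) ∧
    ∃ x : M, x.1 = lam.toZFSet ∧ (j x).1 ≠ x.1

/-- "`κ` is a cardinal", relativized to the class `W`: no function in `W` maps a smaller ordinal
onto `κ`. -/
def IsCardinalIn (W : Set ZFSet.{u}) (κ : Ordinal.{u}) : Prop :=
  ∀ μ < κ, ∀ f ∈ W, ¬ (ZFSet.IsFunc μ.toZFSet κ.toZFSet f ∧
    ∀ y ∈ κ.toZFSet, ∃ x ∈ μ.toZFSet, ZFSet.pair x y ∈ f)

/-- "`κ` is an extremely reflective cardinal", relativized to the class `W`: the parameter `a`, the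
transitive models `M` and `N` and the embedding `j` (as a set of ordered pairs, called `g`) range
over `W`. For `W = Set.univ` this is the notion in the universe of all sets. For `W = V_θ` with
`θ > ω` a limit ordinal it says that `V_θ` satisfies "`κ` is an extremely reflective cardinal": the notions
`V_lam`, transitive set, satisfaction in a set, and elementary embedding between sets, are
absolute for such `W`. -/
def IsExtremelyReflectiveIn (W : Set ZFSet.{u}) (κ : Ordinal.{u}) : Prop :=
  κ.toZFSet ∈ W ∧ IsCardinalIn W κ ∧
    ∀ a ∈ W, ∃ lam < κ, ∃ M ∈ W, ∃ N ∈ W, ∃ g ∈ W,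
      M.IsTransitive ∧ N.IsTransitive ∧ M ⊨ ZFC ∧ N ⊨ ZFC ∧
      V_ lam ⊆ M ∧ V_ lam ∈ M ∧ a ∈ N ∧
      ∃ j : M ↪ₑ[setLang] N,
        (∀ z, z ∈ g ↔ ∃ x : M, z = ZFSet.pair x.1 (j x).1) ∧
        IsCriticalPoint j lam ∧
        ∀ x : M, x.1 = lam.toZFSet → (j x).1 = κ.toZFSet

/-- "There is a proper class of extremely reflective cardinals", relativized to `W`: no set in `W`
has all of them as elements. -/
def ProperClassOfExtremelyReflective (W : Set ZFSet.{u}) : Prop :=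
  ∀ x ∈ W, ∃ κ, IsExtremelyReflectiveIn W κ ∧ κ.toZFSet ∉ x

end SetTheoryLang

/-! Write `κ` for the least `ω`-Erdős cardinal. Everything rests on the fact that `κ` is subtle
(`exists_coherent_pair`): for every club `C` and sets `A a` there are `a < b` in `C` with `A a` and
`A b` equal below `a`.

Suppose subtlety fails for `C` and `A`, and let `f a b < a` witness the disagreement of `A a` and `A
b`. Homogeneity yields increasing `ω`-sequences indiscernible for countably many predicates; take
one with least first term. Minimality and the choice of `κ` put its terms into `C`. Then compare `f
(I 0) (I 1)` with `f (I 2) (I 3)`. If it is smaller, the values of `f` form an indiscernible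
sequence with a smaller first term; if it is larger, they descend forever; if the two are equal, one
point distinguishes three sets `A` pairwise, although membership has only two truth values.

Subtlety gives inaccessibility: an injection of `κ` into a power set of a smaller cardinal, or a
short cofinal set, would define an `A` without coherent pairs. Hence `V_κ` satisfies ZFC, and so
does `V_θ` for club many `θ < κ`.

For stationarity, suppose a club contains no extremely reflective cardinal. For each of its
cardinals `a` pick a parameter `s a` at which reflection fails, and `θ a` with `V_(θ a)` a model of
ZFC that contains `a` and `s a`. Take an elementary substructure of size `|V_a|` including `V_a ∪
{a, V_a}`, name its elements by elements of `V_a`, and code the true formulas about named elements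
as a subset of `a`. For a coherent pair `a < b`, sending the element named `q` at `a` to the element
named `q` at `b` is elementary from the collapse at `a` to `V_(θ b)`, fixes `V_a` pointwise and
sends `a` to `b`. So `b` reflects for `s b`, a contradiction. -/

namespace SetTheoryLang

/-! ### Homogeneous sets and indiscernible sequences -/

/-- The set `H` is homogeneous for the colouring `f` of finite sets. -/
def Homogeneous {X : Type*} (f : Finset X → Bool) (H : Set X) : Prop :=
  ∀ s t : Finset X, (s : Set X) ⊆ H → (t : Set X) ⊆ H → s.card = t.card → f s = f t

/-- Every colouring of the finite subsets of `X` has an infinite homogeneous set. -/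
def HasInfiniteHomogeneous (X : Type*) : Prop :=
  ∀ f : Finset X → Bool, ∃ H : Set X, H.Infinite ∧ Homogeneous f H

theorem HasInfiniteHomogeneous.of_embedding {X Y : Type*} (h : HasInfiniteHomogeneous X)
    (e : X ↪ Y) : HasInfiniteHomogeneous Y := by
  classical
  intro f
  obtain ⟨H, hH, hf⟩ := h fun s => f (s.map e)
  refine ⟨e '' H, hH.image e.injective.injOn, fun s t hs ht hst => ?_⟩
  obtain ⟨s, hs', rfl⟩ := Finset.subset_set_image_iff.1 hs
  obtain ⟨t, ht', rfl⟩ := Finset.subset_set_image_iff.1 ht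
  rw [Finset.card_image_of_injective _ e.injective,
    Finset.card_image_of_injective _ e.injective] at hst
  simpa [Finset.map_eq_image] using hf s t hs' ht' hst

/-- Colour a set by whether it has an element below its cardinality. If `x` lies in an infinite `H`,
sets of size `x + 1` in `H` receive both colours: one contains `x`, the other lies above `x + 1`. -/
theorem not_hasInfiniteHomogeneous_nat : ¬ HasInfiniteHomogeneous ℕ := by
  classical
  intro h
  obtain ⟨H, hH, hf⟩ := h fun s => decide (∃ x ∈ s, x < s.card)
  obtain ⟨x, hx⟩ := hH.nonempty
  have hinf : (H \ Set.Iic (x + 1)).Infinite := hH.sdiff (Set.finite_Iic _)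
  obtain ⟨t, ht, htc⟩ := hinf.exists_subset_card_eq (x + 1)
  obtain ⟨s, hs, hsc⟩ := hinf.exists_subset_card_eq x
  have hxs : x ∉ s := fun hxs => by simpa using (hs hxs).2
  have := hf (insert x s) t
    (by
      rw [Finset.coe_insert]
      exact Set.insert_subset hx (hs.trans Set.sdiff_subset))
    (ht.trans Set.sdiff_subset) (by rw [Finset.card_insert_of_notMem hxs, hsc, htc])
  rw [decide_eq_decide] at this
  obtain ⟨y, hy, hlt⟩ := this.1 ⟨x, by simp, by rw [Finset.card_insert_of_notMem hxs, hsc]; simp⟩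
  have := (ht hy).2
  simp only [Set.mem_Iic, not_le] at this
  omega

section Sequences

variable {α : Type*}

/-- The predicate `R` depends on finitely many terms of a sequence only. -/
def FinitelySupported (R : (ℕ → α) → Prop) : Prop :=
  ∃ k, ∀ u v : ℕ → α, (∀ i < k, u i = v i) → (R u ↔ R v)

/-- The sequence `I` is increasing and indiscernible for the predicate `R`. -/
def Indiscernible (R : (ℕ → α) → Prop) (I : ℕ → α) : Prop :=
  ∀ σ τ : ℕ → ℕ, StrictMono σ → StrictMono τ → (R (I ∘ σ) ↔ R (I ∘ τ))

/-- Apply a unary function to the terms of a sequence (`false`), or a binary function to its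
consecutive pairs of terms (`true`). -/
def seqStep (h : α → α) (f : α → α → α) : Bool → (ℕ → α) → ℕ → α
  | false, u => fun k => h (u k)
  | true, u => fun k => f (u (2 * k)) (u (2 * k + 1))

/-- Apply `seqStep` repeatedly. -/
def seqSteps (h : α → α) (f : α → α → α) : List Bool → (ℕ → α) → ℕ → α
  | [], u => u
  | c :: w, u => seqSteps h f w (seqStep h f c u)

theorem FinitelySupported.comp_seqSteps {R : (ℕ → α) → Prop} (hR : FinitelySupported R)
    (h : α → α) (f : α → α → α) (w : List Bool) :
    FinitelySupported fun u => R (seqSteps h f w u) := by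
  induction w with
  | nil => exact hR
  | cons c w ih =>
    obtain ⟨k, hk⟩ := ih
    refine ⟨2 * k, fun u v huv => hk _ _ fun i hi => ?_⟩
    cases c with
    | false => simp only [seqStep]; rw [huv i (by omega)]
    | true => simp only [seqStep]; rw [huv (2 * i) (by omega), huv (2 * i + 1) (by omega)]

/-- A subsequence of the derived sequence is derived from a subsequence: keep the pair `(2m, 2m +
1)` exactly when `σ` keeps `m`. Thus indiscernibility passes from a sequence to its derived
sequences. -/
theorem exists_seqStep_comp (h : α → α) (f : α → α → α) (c : Bool) (I : ℕ → α) {σ : ℕ → ℕ}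
    (hσ : StrictMono σ) :
    ∃ τ : ℕ → ℕ, StrictMono τ ∧ seqStep h f c I ∘ σ = seqStep h f c (I ∘ τ) := by
  cases c with
  | false => exact ⟨σ, hσ, rfl⟩
  | true =>
    refine ⟨fun n => 2 * σ (n / 2) + n % 2, strictMono_nat_of_lt_succ fun n => ?_, ?_⟩
    · rcases Nat.even_or_odd' n with ⟨m, rfl | rfl⟩
      · have h1 : (2 * m + 1) / 2 = m := by omega
        have h2 : (2 * m) / 2 = m := by omega
        simp only [h1, h2]; omega
      · have h1 : (2 * m + 1) / 2 = m := by omega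
        have h2 : (2 * m + 1 + 1) / 2 = m + 1 := by omega
        have := hσ m.lt_succ_self
        simp only [h1, h2]; simp only [Nat.succ_eq_add_one] at this; omega
    · funext n
      have h1 : (2 * n + 1) / 2 = n := by omega
      have h2 : (2 * n) / 2 = n := by omega
      have h3 : (2 * n + 1) % 2 = 1 := by omega
      have h4 : (2 * n) % 2 = 0 := by omega
      simp [seqStep, h1, h3]

end Sequences

theorem exists_strictMono_image_range (s : Finset ℕ) :
    ∃ σ : ℕ → ℕ, StrictMono σ ∧ s = (Finset.range s.card).image σ := by
  classical
  let σ : ℕ → ℕ := fun i =>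
    if h : i < s.card then s.orderEmbOfFin rfl ⟨i, h⟩ else s.sup id + 1 + i
  have hσ : StrictMono σ := by
    intro i j hij
    by_cases hj : j < s.card
    · have hi : i < s.card := hij.trans hj
      simp only [σ, hi, hj, dif_pos]
      exact (s.orderEmbOfFin rfl).strictMono hij
    · by_cases hi : i < s.card
      · simp only [σ, hi, hj, dif_pos, dif_neg, not_false_eq_true]
        have : s.orderEmbOfFin rfl ⟨i, hi⟩ ≤ s.sup id :=
          Finset.le_sup (f := id) (s.orderEmbOfFin_mem rfl ⟨i, hi⟩)
        omega
      · simp only [σ, hi, hj, dif_neg, not_false_eq_true]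
        omega
  refine ⟨σ, hσ, (Finset.eq_of_subset_of_card_le ?_ ?_).symm⟩
  · intro x hx
    obtain ⟨i, hi, rfl⟩ := Finset.mem_image.1 hx
    simp only [σ, Finset.mem_range.1 hi, dif_pos]
    exact s.orderEmbOfFin_mem rfl _
  · rw [Finset.card_image_of_injective _ hσ.injective, Finset.card_range]

theorem eq_of_image_range_eq {α : Type*} [LinearOrder α] {u v : ℕ → α} (hu : StrictMono u) (hv : StrictMono v) {n : ℕ}
    (h : (Finset.range n).image u = (Finset.range n).image v) : ∀ i < n, u i = v i := by
  have hc : ((Finset.range n).image v).card = n := by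
    rw [Finset.card_image_of_injective _ hv.injective, Finset.card_range]
  have key : ∀ w : ℕ → α, StrictMono w → (Finset.range n).image w = (Finset.range n).image v →
      (fun i : Fin n => w i) = ((Finset.range n).image v).orderEmbOfFin hc := fun w hw hwv =>
    Finset.orderEmbOfFin_unique hc
      (fun i => hwv ▸ Finset.mem_image_of_mem w (Finset.mem_range.2 i.2)) fun i j hij => hw hij
  intro i hi
  exact congr_fun ((key u hu h).trans (key v hv rfl).symm) ⟨i, hi⟩

theorem homogeneous_range_of_indiscernible {α : Type*} [LinearOrder α] {I : ℕ → α} (hI : StrictMono I)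
    (g : Finset α → Bool)
    (h : ∀ n, Indiscernible (fun u => g ((Finset.range n).image u) = true) I) :
    Homogeneous g (Set.range I) := by
  intro s t hs ht hst
  rw [← Set.image_univ] at hs ht
  obtain ⟨s', -, rfl⟩ := Finset.subset_set_image_iff.1 hs
  obtain ⟨t', -, rfl⟩ := Finset.subset_set_image_iff.1 ht
  rw [Finset.card_image_of_injective _ hI.injective,
    Finset.card_image_of_injective _ hI.injective] at hst
  obtain ⟨σ, hσ, hs'⟩ := exists_strictMono_image_range s'
  obtain ⟨τ, hτ, ht'⟩ := exists_strictMono_image_range t'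
  have := h s'.card σ τ hσ hτ
  simp only at this
  rw [← Finset.image_image, ← Finset.image_image, ← hs', hst, ← ht'] at this
  exact Bool.eq_iff_iff.2 this

theorem exists_coloring_of_not_hasInfiniteHomogeneous {α : Type*} [LinearOrder α]
    {a : α}
    (h : ¬ HasInfiniteHomogeneous (Set.Iio a)) :
    ∃ g : Finset α → Bool, ∀ H ⊆ Set.Iio a, H.Infinite → ¬ Homogeneous g H := by
  classical
  simp only [HasInfiniteHomogeneous, not_forall, not_exists, not_and] at h
  obtain ⟨f, hf⟩ := h
  refine ⟨fun s => f (s.subtype (· < a)), fun H hHa hH hg => hf (Subtype.val ⁻¹' H) ?_ ?_⟩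
  · exact hH.preimage (hHa.trans_eq Subtype.range_coe.symm)
  · intro s t hs ht hst
    have key : ∀ s : Finset (Set.Iio a),
        (s.map (Function.Embedding.subtype _)).subtype (· < a) = s := fun s => by
      ext x; simp only [Finset.mem_subtype, Finset.mem_map, Function.Embedding.subtype_apply]
      exact ⟨fun ⟨y, hy, hyx⟩ => by rwa [← Subtype.ext (a1 := y) (a2 := x) hyx], fun h => ⟨x, h, rfl⟩⟩
    have := hg (s.map (Function.Embedding.subtype _)) (t.map (Function.Embedding.subtype _))
      (by intro x; simpa using fun h hx => hs hx) (by intro x; simpa using fun h hx => ht hx)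
      (by simpa using hst)
    simpa only [key] using this

/-! ### Indiscernibles in well orders, and subtlety. -/

section WellOrder

variable {α : Type*} [LinearOrder α] [WellFoundedLT α]

theorem exists_strictMono_of_infinite {H : Set α} (hH : H.Infinite) :
    ∃ I : ℕ → α, StrictMono I ∧ ∀ n, I n ∈ H := by
  have := hH.to_subtype
  let f := Infinite.natEmbedding H
  obtain ⟨g, hg | hg⟩ := exists_increasing_or_nonincreasing_subseq (· < ·) fun n => (f n : α)
  · exact ⟨fun n => f (g n), fun m n hmn => hg m n hmn, fun n => (f (g n)).2⟩
  · have hanti : StrictAnti fun n => (f (g n) : α) := fun m n hmn =>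
      lt_of_le_of_ne (not_lt.1 (hg m n hmn)) fun h =>
        hmn.ne' (g.injective (f.injective (Subtype.ext h)))
    exact ((RelEmbedding.natGT _ fun n => hanti n.lt_succ_self).not_wellFounded
      wellFounded_lt).elim

/-- Homogeneity treats each cardinality separately, so a single colouring handles countably many
predicates: each gets its own cardinality, large enough for a set of that size to determine the
relevant terms. -/
theorem exists_indiscernible (hE : HasInfiniteHomogeneous α) {ι : Type*} [Countable ι]
    (R : ι → (ℕ → α) → Prop) (hR : ∀ m, FinitelySupported (R m)) :
    ∃ I : ℕ → α, StrictMono I ∧ ∀ m, Indiscernible (R m) I := by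
  classical
  choose k hk using hR
  obtain ⟨c, hc⟩ := exists_injective_nat ι
  -- The first component of the pair makes `N` injective; the pair also bounds its second component,
  -- so `N m ≥ k m`.
  let N : ι → ℕ := fun m => Nat.pair (c m) (k m)
  have hN : Function.Injective N := fun a b hab => hc (Nat.pair_eq_pair.1 hab).1
  obtain ⟨H, hH, hf⟩ := hE fun s => decide (∃ m, N m = s.card ∧ ∃ u : ℕ → α, StrictMono u ∧
    s = (Finset.range s.card).image u ∧ R m u)
  obtain ⟨I, hI, hIH⟩ := exists_strictMono_of_infinite hH
  refine ⟨I, hI, fun m => ?_⟩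
  have hcard : ∀ σ : ℕ → ℕ, StrictMono σ → ((Finset.range (N m)).image (I ∘ σ)).card = N m :=
    fun σ hσ => by
      rw [Finset.card_image_of_injective _ (hI.comp hσ).injective, Finset.card_range]
  have hsub : ∀ σ : ℕ → ℕ, (((Finset.range (N m)).image (I ∘ σ) : Finset α) : Set α) ⊆ H := by
    intro σ x hx
    obtain ⟨i, -, rfl⟩ := Finset.mem_image.1 (Finset.mem_coe.1 hx)
    exact hIH _
  have key : ∀ σ : ℕ → ℕ, StrictMono σ → (R m (I ∘ σ) ↔
      ∃ m', N m' = ((Finset.range (N m)).image (I ∘ σ)).card ∧ ∃ u : ℕ → α, StrictMono u ∧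
        (Finset.range (N m)).image (I ∘ σ) =
          (Finset.range ((Finset.range (N m)).image (I ∘ σ)).card).image u ∧ R m' u) := by
    intro σ hσ
    rw [hcard σ hσ]
    constructor
    · exact fun h => ⟨m, rfl, _, hI.comp hσ, rfl, h⟩
    · rintro ⟨m', hm', u, hu, himg, hRu⟩
      obtain rfl := hN hm'
      refine (hk m' _ _ fun i hi => ?_).2 hRu
      exact eq_of_image_range_eq (hI.comp hσ) hu himg i
        (hi.trans_le (Nat.right_le_pair _ _))
  intro σ τ hσ hτ
  rw [key σ hσ, key τ hτ, ← decide_eq_decide]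
  exact hf _ _ (hsub σ) (hsub τ) ((hcard σ hσ).trans (hcard τ hτ).symm)

/-- Among the increasing sequences that are indiscernible for countably many predicates, one whose
first term is minimal has a first term that no increasing derived sequence can undercut. -/
theorem exists_minimal_indiscernible (hE : HasInfiniteHomogeneous α) {ι : Type*} [Countable ι]
    (R : ι → (ℕ → α) → Prop) (hR : ∀ m, FinitelySupported (R m)) (h : α → α) (f : α → α → α) :
    ∃ I : ℕ → α, StrictMono I ∧ (∀ m, Indiscernible (R m) I) ∧
      ∀ c, StrictMono (seqStep h f c I) → I 0 ≤ seqStep h f c I 0 := by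
  -- Precomposing with all words of derivation steps makes `S` closed under increasing derived
  -- sequences; minimality of the first term can then be applied to them.
  let S : Set (ℕ → α) := {I | StrictMono I ∧ ∀ m : ι × List Bool,
    Indiscernible (fun u => R m.1 (seqSteps h f m.2 u)) I}
  have hS : S.Nonempty := exists_indiscernible hE (fun (m : ι × List Bool) u =>
    R m.1 (seqSteps h f m.2 u)) fun m => (hR m.1).comp_seqSteps h f m.2
  obtain ⟨I, hIS, hmin⟩ := (InvImage.wf (fun I : ℕ → α => I 0) wellFounded_lt).has_min S hS
  refine ⟨I, hIS.1, fun m => hIS.2 (m, []), fun c hc => not_lt.1 fun hlt => ?_⟩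
  refine hmin (seqStep h f c I) ⟨hc, fun m σ τ hσ hτ => ?_⟩ hlt
  obtain ⟨σ', hσ', eσ⟩ := exists_seqStep_comp h f c I hσ
  obtain ⟨τ', hτ', eτ⟩ := exists_seqStep_comp h f c I hτ
  rw [eσ, eτ]
  exact hIS.2 (m.1, c :: m.2) σ' τ' hσ' hτ'

/-- The floor of `x` is the supremum of the members of `C` up to `x`, which lies in `C` by closure.
The least element `b` is adjoined for points below all of `C`. -/
theorem exists_floor {C : Set α} (hC : DirSupClosed C) {b : α} (hb : ∀ x, b ≤ x) (x : α) :
    ∃ y ∈ insert b C, y ≤ x ∧ ∀ c ∈ insert b C, c ≤ x → c ≤ y := by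
  by_cases h : ∃ c ∈ C, c ≤ x
  · let t : Set α := {c ∈ C | c ≤ x}
    obtain ⟨y, hy, hmin⟩ := WellFounded.has_min (wellFounded_lt (α := α)) (upperBounds t)
      ⟨x, fun c hc => hc.2⟩
    have hlub : IsLUB t y := ⟨hy, fun z hz => not_lt.1 (hmin z hz)⟩
    refine ⟨y, .inr (hC (fun c hc => hc.1) h (.of_linearOrder _) hlub),
      hlub.2 fun c hc => hc.2, ?_⟩
    rintro c (rfl | hc) hcx
    · exact hb _
    · exact hy ⟨hc, hcx⟩
  · refine ⟨b, .inl rfl, hb x, ?_⟩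
    rintro c (rfl | hc) hcx
    · exact le_rfl
    · exact (h ⟨c, hc, hcx⟩).elim

/-- A limit well order with infinite homogeneous sets, none of whose proper initial segments has
them, is subtle. -/
theorem exists_coherent_pair [NoMaxOrder α] (hE : HasInfiniteHomogeneous α)
    (hI : ∀ a : α, ¬ HasInfiniteHomogeneous (Set.Iio a)) {C : Set α} (hC : IsClub C)
    (A : α → Set α) :
    ∃ a ∈ C, ∃ b ∈ C, a < b ∧ ∀ x < a, (x ∈ A a ↔ x ∈ A b) := by
  classical
  by_contra! hcon
  obtain ⟨H₀, hH₀, -⟩ := hE fun _ => true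
  obtain ⟨b₀, -, hbot⟩ := WellFounded.has_min (wellFounded_lt (α := α)) Set.univ
    ⟨hH₀.nonempty.some, trivial⟩
  replace hbot : ∀ x, b₀ ≤ x := fun x => not_lt.1 (hbot x trivial)
  choose h hC' hle hmax using exists_floor hC.dirSupClosed hbot
  choose g hg using fun a => exists_coloring_of_not_hasInfiniteHomogeneous (hI a)
  have hnext : ∀ x, ∃ c ∈ C, x < c := fun x => by
    obtain ⟨y, hy⟩ := exists_gt x
    obtain ⟨c, hc, hyc⟩ := hC.isCofinal y
    exact ⟨c, hc, hy.trans_le hyc⟩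
  choose N hNC hN using hnext
  have hf : ∀ a b, ∃ x, a ∈ C → b ∈ C → a < b → x < a ∧ ¬ (x ∈ A a ↔ x ∈ A b) := fun a b => by
    by_cases hab : a ∈ C ∧ b ∈ C ∧ a < b
    · obtain ⟨x, hx, hxA⟩ := hcon a hab.1 b hab.2.1 hab.2.2
      exact ⟨x, fun _ _ _ => ⟨hx, by tauto⟩⟩
    · exact ⟨a, by tauto⟩
  choose f hf using hf
  -- Predicates 0, 1 and 4 serve to put the terms into `C`, 2 and 3 compare values of `f`, and the
  -- rest transfer the bad colouring below the next club point to the sequence.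
  let R : ℕ → (ℕ → α) → Prop := fun m u => match m with
    | 0 => u 0 ∈ insert b₀ C
    | 1 => h (u 0) < h (u 1)
    | 2 => f (u 0) (u 1) < f (u 2) (u 3)
    | 3 => f (u 0) (u 1) = f (u 2) (u 3)
    | 4 => u 0 ∈ C
    | n + 5 => g (N (h (u 0))) ((Finset.range n).image u) = true
  have hR : ∀ m, FinitelySupported (R m) := fun m => by
    refine ⟨m + 4, fun u v huv => ?_⟩
    have h0 := huv 0 (by omega)
    have h1 := huv 1 (by omega)
    have h2 := huv 2 (by omega)
    have h3 := huv 3 (by omega)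
    match m with
    | 0 | 1 | 2 | 3 | 4 => simp only [R, h0, h1, h2, h3]
    | n + 5 =>
      have : (Finset.range n).image u = (Finset.range n).image v :=
        Finset.image_congr fun i hi => huv i (by have := Finset.mem_range.1 hi; omega)
      simp only [R, h0, this]
  obtain ⟨I, hmono, hind, hmin⟩ := exists_minimal_indiscernible hE R hR h f
  have hadd : ∀ k, StrictMono fun n : ℕ => n + k := fun k => strictMono_id.add_const k
  -- the terms of `I` belong to the club
  have hIC : ∀ k, I k ∈ insert b₀ C := by
    by_contra hnot
    have hnot : ∀ k, I k ∉ insert b₀ C := by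
      obtain ⟨k, hk⟩ := not_forall.1 hnot
      intro l hl
      have := (hind 0 _ _ (hadd l) (hadd k)).1 (by simpa [R] using hl)
      exact hk (by simpa [R] using this)
    -- Either the floors increase, and minimality makes `I 0` its own floor, or they are constant,
    -- and the sequence lies below one point `N (h (I 0))`, where `g` forbids an infinite
    -- homogeneous set.
    by_cases h01 : h (I 0) < h (I 1)
    · have hh : StrictMono fun k => h (I k) := strictMono_nat_of_lt_succ fun k => by
        have := (hind 1 _ _ (hadd 0) (hadd k)).1 (by simpa [R] using h01)
        simpa [R, add_comm] using this
      have := hmin false hh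
      exact hnot 0 (le_antisymm (hle (I 0)) this ▸ hC' (I 0))
    · have hconst : ∀ k, h (I k) = h (I 0) := by
        intro k
        induction k with
        | zero => rfl
        | succ k ih =>
          refine le_antisymm ?_ (hmax _ _ (hC' _) ((hle _).trans (hmono.monotone (Nat.zero_le _))))
          rw [← ih]
          refine not_lt.1 fun hlt => h01 ?_
          have := (hind 1 _ _ (hadd k) (hadd 0)).1 (by simpa [R, add_comm] using hlt)
          simpa [R] using this
      refine hg (N (h (I 0))) (Set.range I) ?_ (Set.infinite_range_of_injective hmono.injective)
        (homogeneous_range_of_indiscernible hmono _ fun n σ τ hσ hτ => ?_)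
      · rintro _ ⟨k, rfl⟩
        refine not_le.1 fun hk => (hN (h (I 0))).not_ge ?_
        exact (hmax _ _ (.inr (hNC _)) hk).trans_eq (hconst k)
      · simpa only [R, Function.comp_apply, hconst] using hind (n + 5) σ τ hσ hτ
  replace hIC : ∀ k, I k ∈ C := fun k => by
    have h1 : I 1 ∈ C := (hIC 1).resolve_left ((hbot _).trans_lt (hmono Nat.zero_lt_one)).ne'
    simpa [R] using (hind 4 _ _ (hadd 1) (hadd k)).1 (by simpa [R] using h1)
  have hfI : ∀ {m n}, m < n → f (I m) (I n) < I m ∧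
      ¬ (f (I m) (I n) ∈ A (I m) ↔ f (I m) (I n) ∈ A (I n)) :=
    fun h => hf _ _ (hIC _) (hIC _) (hmono h)
  -- In this case the values on consecutive pairs increase, but their first one is below `I 0`,
  -- against minimality.
  by_cases h2 : f (I 0) (I 1) < f (I 2) (I 3)
  · have hF : StrictMono (seqStep h f true I) := strictMono_nat_of_lt_succ fun k => by
      have := (hind 2 _ _ (hadd 0) (hadd (2 * k))).1 (by simpa [R] using h2)
      simp only [R, Function.comp_apply] at this
      change f (I (2 * k)) (I (2 * k + 1)) < f (I (2 * (k + 1))) (I (2 * (k + 1) + 1))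
      convert! this using 3 <;> omega
    exact (hmin true hF).not_gt (hfI Nat.zero_lt_one).1
  by_cases h3 : f (I 0) (I 1) = f (I 2) (I 3)
  · -- the value of `f` is constant on pairs of terms of `I`
    have heq : ∀ a b c d : ℕ, a < b → b < c → c < d → f (I a) (I b) = f (I c) (I d) := by
      intro a b c d hab hbc hcd
      let σ : ℕ → ℕ := fun n => match n with
        | 0 => a
        | 1 => b
        | 2 => c
        | n + 3 => d + n
      have hσ : StrictMono σ := strictMono_nat_of_lt_succ fun n => match n with
        | 0 => hab
        | 1 => hbc
        | 2 => hcd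
        | n + 3 => by simp only [σ]; omega
      simpa [R, σ] using (hind 3 _ _ (hadd 0) hσ).1 (by simpa [R] using h3)
    have e01 := heq 0 1 3 4 (by omega) (by omega) (by omega)
    have e12 := heq 1 2 3 4 (by omega) (by omega) (by omega)
    have e02 := heq 0 2 3 4 (by omega) (by omega) (by omega)
    have n01 := (hfI (show 0 < 1 by omega)).2
    have n12 := (hfI (show 1 < 2 by omega)).2
    have n02 := (hfI (show 0 < 2 by omega)).2
    rw [e01] at n01
    rw [e12] at n12
    rw [e02] at n02
    tauto
  -- The remaining case would produce an infinite descending sequence.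
  · have hanti : ∀ k, f (I (2 * (k + 1))) (I (2 * (k + 1) + 1)) < f (I (2 * k)) (I (2 * k + 1)) := by
      intro k
      have n2 : ¬ R 2 (I ∘ (· + 2 * k)) := fun h => h2 <| by
        simpa [R] using (hind 2 _ _ (hadd (2 * k)) (hadd 0)).1 h
      have n3 : ¬ R 3 (I ∘ (· + 2 * k)) := fun h => h3 <| by
        simpa [R] using (hind 3 _ _ (hadd (2 * k)) (hadd 0)).1 h
      simp only [R, Function.comp_apply] at n2 n3
      have := lt_of_le_of_ne (not_lt.1 n2) (Ne.symm n3)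
      convert! this using 3 <;> omega
    exact (RelEmbedding.natGT (fun k => f (I (2 * k)) (I (2 * k + 1))) hanti).not_wellFounded
      wellFounded_lt

end WellOrder

/-! ### The least `ω`-Erdős cardinal is inaccessible -/

section Erdos

open Cardinal Ordinal

/-- Every infinite subset of a well order includes one of order type `ω`, and homogeneity passes to
subsets. The order-free form transfers along injections, so only cardinality matters. -/
theorem isOmegaErdos_iff_hasInfiniteHomogeneous (κ : Cardinal.{u}) :
    IsOmegaErdos κ ↔ HasInfiniteHomogeneous (Set.Iio κ.ord) := by
  constructor
  · intro h f
    obtain ⟨H, ⟨e⟩, hf⟩ := h f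
    exact ⟨H, Set.infinite_coe_iff.1 (Infinite.of_injective e e.injective), hf⟩
  · intro h f
    obtain ⟨H, hH, hf⟩ := h f
    obtain ⟨I, hI, hIH⟩ := exists_strictMono_of_infinite hH
    have hsub : Set.range I ⊆ H := by rintro _ ⟨n, rfl⟩; exact hIH n
    exact ⟨Set.range I, ⟨hI.orderIso⟩,
      fun s t hs ht => hf s t (hs.trans hsub) (ht.trans hsub)⟩

theorem noMaxOrder_Iio_ord {κ : Cardinal.{u}} (hκ : ℵ₀ ≤ κ) : NoMaxOrder (Set.Iio κ.ord) :=
  ⟨fun a => ⟨⟨Order.succ a.1, (isSuccLimit_ord hκ).succ_lt a.2⟩, Order.lt_succ a.1⟩⟩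

theorem isClub_Ici {α : Type*} [LinearOrder α] (m : α) : IsClub (Set.Ici m) := by
  refine ⟨fun t ht ⟨b, hb⟩ _ a ha => (ht hb).trans (ha.1 hb), fun a => ?_⟩
  exact ⟨a ⊔ m, le_sup_right, le_sup_left⟩

theorem mk_Iio_Iio {o : Ordinal.{u}} (a : Set.Iio o) :
    #(Set.Iio a) = Cardinal.lift.{u + 1} a.1.card := by
  rw [← Cardinal.mk_Iio_ordinal]
  refine mk_congr ⟨fun x => ⟨x.1.1, x.2⟩, fun x => ⟨⟨x.1, lt_trans (Set.mem_Iio.1 x.2) a.2⟩, x.2⟩,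
    fun _ => rfl, fun _ => rfl⟩

variable {κ : Cardinal.{u}} (hκ : IsLeast {μ : Cardinal.{u} | IsOmegaErdos μ} κ)

include hκ

theorem not_hasInfiniteHomogeneous_of_lt {X : Type (u + 1)} (hX : #X < Cardinal.lift.{u + 1} κ) :
    ¬ HasInfiniteHomogeneous X := by
  intro h
  obtain ⟨μ, hμ⟩ := mem_range_lift_of_le hX.le
  rw [← hμ, Cardinal.lift_lt] at hX
  refine (hκ.2 ((isOmegaErdos_iff_hasInfiniteHomogeneous μ).2 ?_)).not_gt hX
  have : #X ≤ #(Set.Iio μ.ord) := by rw [Cardinal.mk_Iio_ordinal, card_ord, hμ]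
  exact h.of_embedding this.some

theorem aleph0_lt_of_isLeast : ℵ₀ < κ := by
  by_contra! hle
  have h := (isOmegaErdos_iff_hasInfiniteHomogeneous κ).1 hκ.1
  have : Cardinal.lift.{0} #(Set.Iio κ.ord) ≤ Cardinal.lift.{u + 1} #ℕ := by
    simpa [Cardinal.mk_Iio_ordinal] using hle
  exact not_hasInfiniteHomogeneous_nat (h.of_embedding (lift_mk_le'.1 this).some)

theorem exists_coherent_pair_Iio_ord {C : Set (Set.Iio κ.ord)} (hC : IsClub C)
    (A : Set.Iio κ.ord → Set (Set.Iio κ.ord)) :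
    ∃ a ∈ C, ∃ b ∈ C, a < b ∧ ∀ x < a, (x ∈ A a ↔ x ∈ A b) := by
  have := noMaxOrder_Iio_ord (aleph0_lt_of_isLeast hκ).le
  refine exists_coherent_pair ((isOmegaErdos_iff_hasInfiniteHomogeneous κ).1 hκ.1)
    (fun a => not_hasInfiniteHomogeneous_of_lt hκ ?_) hC A
  rw [mk_Iio_Iio, Cardinal.lift_lt]
  exact lt_ord.1 a.2

/-- If `κ ≤ 2 ^ μ` with `μ < κ`, distinct ordinals below `κ` get distinct subsets of `μ`; a coherent
pair above `μ` would get the same one. -/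
theorem isStrongPrelimit_of_isLeast : IsStrongPrelimit κ := by
  intro μ hμ
  by_contra! hle
  have hm : μ.ord < κ.ord := ord_lt_ord.2 hμ
  let m : Set.Iio κ.ord := ⟨μ.ord, hm⟩
  have h : #(Set.Iio κ.ord) ≤ #(Set (Set.Iio m)) := by
    rw [mk_set, mk_Iio_Iio, Cardinal.mk_Iio_ordinal, card_ord, card_ord, ← lift_two_power]
    exact Cardinal.lift_le.2 hle
  obtain ⟨e⟩ := h
  obtain ⟨a, ha, b, hb, hab, hAB⟩ := exists_coherent_pair_Iio_ord hκ
    (isClub_Ici m) fun a => Subtype.val '' e a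
  refine hab.ne (e.injective ?_)
  ext x
  have hx : x.1 < m := x.2
  simpa [hx] using hAB x.1 (hx.trans_le ha)

/-- Let `A a` be the singleton of the index, below `m`, of the next point of the short cofinal set
`D` after `a`. A coherent pair `a < b` has the same next point, yet `b`, being in the closure of
`D`, has a point of `D` in `(a, b]`. -/
theorem le_cof_ord_of_isLeast : κ ≤ κ.ord.cof := by
  by_contra! hlt
  have hm : κ.ord.cof.ord < κ.ord := ord_lt_ord.2 hlt
  let m : Set.Iio κ.ord := ⟨κ.ord.cof.ord, hm⟩
  obtain ⟨D, hD, hDc⟩ := Order.exists_cof_eq (Set.Iio κ.ord)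
  have h : #D ≤ #(Set.Iio m) := by
    rw [hDc, mk_Iio_Iio, cof_Iio, ← lift_cof, card_ord]
  obtain ⟨e⟩ := h
  have := noMaxOrder_Iio_ord (aleph0_lt_of_isLeast hκ).le
  -- the closure of `D` above `m`
  let C : Set (Set.Iio κ.ord) := {a | m ≤ a ∧ ∀ x < a, ∃ d ∈ D, x < d ∧ d ≤ a}
  have hC : IsClub C := by
    refine ⟨fun t ht hne _ a ha => ?_, fun a => ?_⟩
    · obtain ⟨b, hb⟩ := hne
      refine ⟨(ht hb).1.trans (ha.1 hb), fun x hx => ?_⟩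
      obtain ⟨c, hc, hxc⟩ := (lt_isLUB_iff ha).1 hx
      obtain ⟨d, hd, hxd, hdc⟩ := (ht hc).2 x hxc
      exact ⟨d, hd, hxd, hdc.trans (ha.1 hc)⟩
    · obtain ⟨d, hd, had⟩ := hD (a ⊔ m)
      exact ⟨d, ⟨le_sup_right.trans had, fun x hx => ⟨d, hd, hx, le_rfl⟩⟩, le_sup_left.trans had⟩
  have hnext : ∀ a : Set.Iio κ.ord, ∃ d : D, a < d ∧ ∀ d' ∈ D, a < d' → d ≤ d' := by
    intro a
    obtain ⟨b, hb⟩ := exists_gt a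
    obtain ⟨d, hd, hbd⟩ := hD b
    obtain ⟨c, hc, hmin⟩ := WellFounded.has_min (wellFounded_lt (α := Set.Iio κ.ord))
      {d ∈ D | a < d} ⟨d, hd, hb.trans_le hbd⟩
    exact ⟨⟨c, hc.1⟩, hc.2, fun d' hd' had' => not_lt.1 (hmin d' ⟨hd', had'⟩)⟩
  choose n hn hnmin using hnext
  obtain ⟨a, ha, b, hb, hab, hAB⟩ := exists_coherent_pair_Iio_ord hκ hC
    fun a => {(e (n a)).1}
  have h := (hAB _ ((e (n a)).2.trans_le ha.1)).1 rfl
  have h' : n a = n b := e.injective (Subtype.ext h)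
  obtain ⟨d, hd, had, hdb⟩ := hb.2 a hab
  have := hnmin a d hd had
  rw [h'] at this
  exact ((hn b).trans_le (this.trans hdb)).false

theorem isInaccessible_of_isLeast : IsInaccessible κ :=
  ⟨aleph0_lt_of_isLeast hκ, le_cof_ord_of_isLeast hκ, isStrongPrelimit_of_isLeast hκ⟩

end Erdos

/-! ### Closed unbounded sets of closure points -/

section Closure

open Cardinal Ordinal

variable {κ : Cardinal.{u}}

theorem exists_lt_ord_of_mk_lt (hκ : IsInaccessible κ) {S : Set Ordinal.{u}}
    (hS : ∀ i ∈ S, i < κ.ord) (hc : #S < Cardinal.lift.{u + 1} κ) :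
    ∃ b < κ.ord, ∀ i ∈ S, i < b := by
  refine ⟨sSup ((· + 1) '' S), sSup_add_one_lt_of_lt_cof ?_ hS, fun i hi => ?_⟩
  · rwa [← lift_cof, hκ.isRegular.cof_ord]
  · refine (Order.lt_add_one_iff.2 le_rfl).trans_le (le_csSup ⟨κ.ord, ?_⟩ ⟨i, hi, rfl⟩)
    rintro _ ⟨j, hj, rfl⟩
    exact Order.add_one_le_of_lt (hS j hj)

theorem cof_Iio_ord_ne_aleph0 (hκ : IsInaccessible κ) : Order.cof (Set.Iio κ.ord) ≠ ℵ₀ := by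
  rw [cof_Iio, ← lift_cof, hκ.isRegular.cof_ord]
  exact (aleph0_lt_lift.2 hκ.aleph0_lt).ne'

/-- By regularity, fewer than `κ` values `e p` are bounded below `κ`. Iterating such a bound `ω`
times reaches a closure point. -/
theorem isClub_closurePoints (hκ : IsInaccessible κ) {P : Type (u + 1)} (ρ e : P → Ordinal.{u})
    (he : ∀ p, e p < κ.ord) (hP : ∀ x < κ.ord, #{p | ρ p ≤ x} < Cardinal.lift.{u + 1} κ) :
    IsClub {a : Set.Iio κ.ord | ∀ p, ρ p < a.1 → e p < a.1} := by
  have hb : ∀ x : Set.Iio κ.ord, ∃ b : Set.Iio κ.ord, x < b ∧ ∀ p, ρ p ≤ x → e p < b := by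
    intro x
    obtain ⟨b, hb, h⟩ := exists_lt_ord_of_mk_lt hκ (S := e '' {p | ρ p ≤ x})
      (by rintro _ ⟨p, -, rfl⟩; exact he p) (mk_image_le.trans_lt (hP x x.2))
    have hlim := isSuccLimit_ord hκ.aleph0_lt.le
    refine ⟨⟨max b (Order.succ x.1), max_lt hb (hlim.succ_lt x.2)⟩,
      (Order.lt_succ x.1).trans_le (le_max_right _ _), fun p hp => ?_⟩
    exact (h _ ⟨p, hp, rfl⟩).trans_le (le_max_left _ _)
  choose b hxb hb using hb
  refine ⟨fun t ht hne _ a ha p hp => ?_, fun a => ?_⟩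
  · have hpa : (⟨ρ p, hp.trans a.2⟩ : Set.Iio κ.ord) < a := hp
    obtain ⟨c, hc, hpc⟩ := (lt_isLUB_iff ha).1 hpa
    exact (ht hc p hpc).trans_le (ha.1 hc)
  · let g : ℕ → Set.Iio κ.ord := fun n => b^[n] a
    have hg : ∀ n, g (n + 1) = b (g n) := fun n => Function.iterate_succ_apply' b n a
    have hsup : ⨆ n, (g n).1 < κ.ord := by
      refine lift_iSup_lt_of_lt_cof ?_ fun n => (g n).2
      rw [← lift_cof, hκ.isRegular.cof_ord]
      simpa using hκ.aleph0_lt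
    have hle : ∀ n, (g n).1 ≤ ⨆ n, (g n).1 := Ordinal.le_iSup fun n => (g n).1
    refine ⟨⟨_, hsup⟩, fun p hp => ?_, hle 0⟩
    obtain ⟨n, hn⟩ := Ordinal.lt_iSup_iff.1 hp
    refine lt_of_lt_of_le ?_ (hle (n + 1))
    rw [hg]
    exact hb _ _ hn.le

theorem mk_sigma_tuples_le {K : ℕ → Type} [∀ n, Countable (K n)] (Q : Type*) :
    #(Σ n, K n × (Fin n → Q)) ≤ max ℵ₀ #Q := by
  let F : (Σ n, K n × (Fin n → Q)) → (Σ n, K n) × List Q := fun p => (⟨p.1, p.2.1⟩, List.ofFn p.2.2)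
  have hF : Function.Injective F := by
    rintro ⟨n, k, q⟩ ⟨m, l, r⟩ h
    simp only [F, Prod.mk.injEq, Sigma.mk.injEq] at h
    obtain ⟨⟨rfl, h1⟩, h2⟩ := h
    obtain rfl := eq_of_heq h1
    rw [List.ofFn_injective h2]
  refine (mk_le_of_injective hF).trans ?_
  rw [mk_prod]
  refine (mul_le_max _ _).trans (max_le (max_le ?_ ?_) (le_max_left _ _))
  · exact (lift_le_aleph0.2 mk_le_aleph0).trans (le_max_left _ _)
  · simpa [max_comm] using mk_list_le_max Q

/-- The supremum of the ranks of the terms of a tuple. -/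
noncomputable def tupleRank {K : ℕ → Type} {Q : Type*} (r : Q → Ordinal.{u})
    (p : Σ n, K n × (Fin n → Q)) : Ordinal.{u} :=
  Finset.univ.sup fun i => r (p.2.2 i)

theorem mk_tupleRank_le_lt {K : ℕ → Type} [∀ n, Countable (K n)] {Q : Type (u + 1)}
    (r : Q → Ordinal.{u}) (x : Ordinal.{u}) (hκ : ℵ₀ < κ)
    (h : #{q | r q ≤ x} < Cardinal.lift.{u + 1} κ) :
    #{p : Σ n, K n × (Fin n → Q) | tupleRank r p ≤ x} < Cardinal.lift.{u + 1} κ := by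
  refine lt_of_le_of_lt ?_ (max_lt (aleph0_lt_lift.2 hκ) h)
  refine le_trans ?_ (mk_sigma_tuples_le (K := K) {q | r q ≤ x})
  refine mk_le_of_surjective (f := fun p => ⟨⟨p.1, p.2.1, fun i => p.2.2 i⟩,
    show tupleRank r _ ≤ x from Finset.sup_le fun i _ => (p.2.2 i).2⟩) ?_
  rintro ⟨⟨n, k, q⟩, hq⟩
  exact ⟨⟨n, k, fun i => ⟨q i,
    (Finset.le_sup (f := fun i => r (q i)) (Finset.mem_univ i)).trans hq⟩⟩, rfl⟩

end Closure

/-! ### Satisfaction of the axioms of ZFC -/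

section Realize

variable {p : ZFSet.{u} → Prop}

@[simp]
theorem realize_memF {n : ℕ} {i j : Fin n} {v : Empty → Subtype p} {xs : Fin n → Subtype p} :
    (memF n i j).Realize v xs ↔ (xs i).1 ∈ (xs j).1 := by
  simp only [memF]
  rfl

@[simp]
theorem realize_eqF {n : ℕ} {i j : Fin n} {v : Empty → Subtype p} {xs : Fin n → Subtype p} :
    (eqF n i j).Realize v xs ↔ xs i = xs j := by
  simp [eqF]

theorem realize_axExtensionality : Subtype p ⊨ axExtensionality ↔
    ∀ x y : Subtype p, (∀ z : Subtype p, z.1 ∈ x.1 ↔ z.1 ∈ y.1) → x = y := by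
  simp [axExtensionality, Sentence.Realize, Formula.Realize, Fin.snoc]

theorem realize_axFoundation : Subtype p ⊨ axFoundation ↔
    ∀ x : Subtype p, (∃ y : Subtype p, y.1 ∈ x.1) →
      ∃ y : Subtype p, y.1 ∈ x.1 ∧ ∀ z : Subtype p, z.1 ∈ y.1 → z.1 ∉ x.1 := by
  simp [axFoundation, Sentence.Realize, Formula.Realize, Fin.snoc]

theorem realize_axPairing : Subtype p ⊨ axPairing ↔
    ∀ x y : Subtype p, ∃ z : Subtype p, ∀ w : Subtype p, w.1 ∈ z.1 ↔ w = x ∨ w = y := by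
  simp [axPairing, Sentence.Realize, Formula.Realize, Fin.snoc]

theorem realize_axUnion : Subtype p ⊨ axUnion ↔
    ∀ x : Subtype p, ∃ y : Subtype p, ∀ z : Subtype p,
      z.1 ∈ y.1 ↔ ∃ w : Subtype p, w.1 ∈ x.1 ∧ z.1 ∈ w.1 := by
  simp [axUnion, Sentence.Realize, Formula.Realize, Fin.snoc]

theorem realize_axPowerSet : Subtype p ⊨ axPowerSet ↔
    ∀ x : Subtype p, ∃ y : Subtype p, ∀ z : Subtype p,
      z.1 ∈ y.1 ↔ ∀ w : Subtype p, w.1 ∈ z.1 → w.1 ∈ x.1 := by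
  simp [axPowerSet, Sentence.Realize, Formula.Realize, Fin.snoc]

theorem realize_axInfinity : Subtype p ⊨ axInfinity ↔
    ∃ x : Subtype p, (∃ y : Subtype p, y.1 ∈ x.1 ∧ ∀ z : Subtype p, z.1 ∉ y.1) ∧
      ∀ y : Subtype p, y.1 ∈ x.1 → ∃ z : Subtype p, z.1 ∈ x.1 ∧
        ∀ w : Subtype p, w.1 ∈ z.1 ↔ w.1 ∈ y.1 ∨ w = y := by
  simp [axInfinity, Sentence.Realize, Formula.Realize, Fin.snoc]

theorem realize_axChoice : Subtype p ⊨ axChoice ↔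
    ∀ x : Subtype p, (∀ y : Subtype p, y.1 ∈ x.1 → ∃ z : Subtype p, z.1 ∈ y.1) →
      (∀ y z : Subtype p, y.1 ∈ x.1 → z.1 ∈ x.1 →
        (∃ w : Subtype p, w.1 ∈ y.1 ∧ w.1 ∈ z.1) → y = z) →
      ∃ c : Subtype p, ∀ y : Subtype p, y.1 ∈ x.1 →
        ∃ z : Subtype p, ∀ w : Subtype p, (w.1 ∈ y.1 ∧ w.1 ∈ c.1) ↔ w = z := by
  simp [axChoice, Sentence.Realize, Formula.Realize, Fin.snoc]

theorem realize_relabel_castAdd {n m k : ℕ} {φ : setLang.Formula (Fin n ⊕ Fin m)}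
    {w : Fin m → Fin (n + k)} {v : Empty → Subtype p} {xs : Fin (n + k) → Subtype p} :
    (BoundedFormula.relabel (n := n + k) (k := 0)
      (Sum.inr ∘ Sum.elim (Fin.castAdd k) w) φ).Realize v xs ↔
      φ.Realize (Sum.elim (xs ∘ Fin.castAdd k) (xs ∘ w)) := by
  rw [BoundedFormula.realize_relabel, Formula.Realize]
  have : Sum.elim v (xs ∘ Fin.castAdd 0) ∘ Sum.inr ∘ Sum.elim (Fin.castAdd k) w =
      Sum.elim (xs ∘ Fin.castAdd k) (xs ∘ w) := by
    funext i
    rcases i with i | i <;> rfl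
  rw [this]
  exact iff_of_eq (congr_arg _ (Subsingleton.elim _ _))

theorem snoc_snoc_castAdd {M : Type*} {n : ℕ} (xs : Fin (n + 1) → M) (a b : M) :
    (Fin.snoc (Fin.snoc xs a : Fin (n + 2) → M) b : Fin (n + 3) → M) ∘ Fin.castAdd 2 = xs := by
  funext i
  exact (Fin.snoc_castSucc (α := fun _ => M) (n := n + 2) b _ i.castSucc).trans
    (Fin.snoc_castSucc (α := fun _ => M) (n := n + 1) a _ i)

theorem snoc_snoc_snoc_castAdd {M : Type*} {n : ℕ} (xs : Fin (n + 1) → M) (a b c : M) :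
    (Fin.snoc (Fin.snoc (Fin.snoc xs a : Fin (n + 2) → M) b : Fin (n + 3) → M) c :
      Fin (n + 4) → M) ∘ Fin.castAdd 3 = xs := by
  funext i
  exact (Fin.snoc_castSucc (α := fun _ => M) (n := n + 3) c _ (i.castAdd 2)).trans
    (congr_fun (snoc_snoc_castAdd xs a b) i)

/-- Append three elements to a tuple. -/
abbrev snoc₃ {M : Type*} {n : ℕ} (xs : Fin (n + 1) → M) (a b c : M) : Fin (n + 4) → M :=
  Fin.snoc (Fin.snoc (Fin.snoc xs a : Fin (n + 2) → M) b : Fin (n + 3) → M) c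

/-- The hypothesis is second-order: `P` is arbitrary, not just definable. This is available in `V_κ`
and avoids any analysis of `φ`. -/
theorem model_axSeparation {n : ℕ} {φ : setLang.Formula (Fin n ⊕ Fin 1)}
    (h : ∀ (P : Subtype p → Prop) (a : Subtype p), ∃ b : Subtype p, ∀ x : Subtype p,
      x.1 ∈ b.1 ↔ x.1 ∈ a.1 ∧ P x) : Subtype p ⊨ axSeparation n φ := by
  simp only [axSeparation, Sentence.Realize, BoundedFormula.realize_alls]
  intro xs
  obtain ⟨b, hb⟩ := h (fun x => φ.Realize (Sum.elim (xs ∘ Fin.castAdd 1) ![x])) (xs (Fin.last n))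
  simp only [BoundedFormula.realize_ex, BoundedFormula.realize_all, BoundedFormula.realize_iff,
    BoundedFormula.realize_inf, realize_memF, realize_relabel_castAdd]
  refine ⟨b, fun x => ?_⟩
  have hc := congr_fun (snoc_snoc_castAdd xs b x)
  convert! hb x using 4
  · simp [Fin.snoc]
  · simp [Fin.snoc]
  · exact hc (Fin.last n)
  · simp [Fin.snoc]
  · funext i; exact hc (i.castAdd 1)
  · funext i; simp [Fin.snoc]

theorem model_axReplacement {n : ℕ} {φ : setLang.Formula (Fin n ⊕ Fin 2)}
    (h : ∀ (P : Subtype p → Subtype p → Prop) (a : Subtype p),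
      (∀ x y z : Subtype p, x.1 ∈ a.1 → P x y → P x z → y = z) →
        ∃ b : Subtype p, ∀ y : Subtype p, y.1 ∈ b.1 ↔ ∃ x : Subtype p, x.1 ∈ a.1 ∧ P x y) :
    Subtype p ⊨ axReplacement n φ := by
  simp only [axReplacement, Sentence.Realize, BoundedFormula.realize_alls]
  intro xs
  specialize h (fun x y => φ.Realize (Sum.elim (xs ∘ Fin.castAdd 1) ![x, y])) (xs (Fin.last n))
  simp only [BoundedFormula.realize_ex, BoundedFormula.realize_all, BoundedFormula.realize_iff,
    BoundedFormula.realize_inf, realize_memF, realize_eqF, BoundedFormula.realize_imp,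
    realize_relabel_castAdd]
  have hc := fun x y z => congr_fun (snoc_snoc_snoc_castAdd xs x y z)
  have key : ∀ (x y z : Subtype p) (i j : Fin 4) (u v : Subtype p),
      snoc₃ xs x y z (Fin.natAdd n i) = u →
      snoc₃ xs x y z (Fin.natAdd n j) = v →
      Sum.elim (snoc₃ xs x y z ∘ Fin.castAdd 4) (snoc₃ xs x y z ∘ ![Fin.natAdd n i, Fin.natAdd n j]) =
      Sum.elim (xs ∘ Fin.castAdd 1) ![u, v] := by
    rintro x y z i j u v rfl rfl
    funext k
    rcases k with k | k
    · exact hc x y z (k.castAdd 1)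
    · fin_cases k <;> rfl
  have e0 : ∀ x y z : Subtype p, snoc₃ xs x y z (Fin.natAdd n (0 : Fin 4)) = xs (Fin.last n) :=
    fun x y z => hc x y z (Fin.last n)
  have e1 : ∀ x y z : Subtype p, snoc₃ xs x y z (Fin.natAdd n (1 : Fin 4)) = x := by
    intro x y z; simp [Fin.snoc]
  have e2 : ∀ x y z : Subtype p, snoc₃ xs x y z (Fin.natAdd n (2 : Fin 4)) = y := by
    intro x y z; simp [Fin.snoc]
  have e3 : ∀ x y z : Subtype p, snoc₃ xs x y z (Fin.natAdd n (3 : Fin 4)) = z := by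
    intro x y z; simp [Fin.snoc]
  simp only [snoc₃] at key e0 e1 e2 e3
  intro hfun
  obtain ⟨b, hb⟩ := h fun x y z hx hy hz => by
    have := hfun x y z
    rw [e0, e1, e2, e3, key x y z 1 2 x y (e1 ..) (e2 ..), key x y z 1 3 x z (e1 ..) (e3 ..)] at this
    exact this hx hy hz
  refine ⟨b, fun y => ?_⟩
  convert! hb y using 2
  · simp [Fin.snoc]
  · simp [Fin.snoc]
  · funext x
    rw [e0, e3, key b y x 3 2 x y (e3 ..) (e2 ..)]

end Realize

/-! ### `V_κ` for an inaccessible cardinal `κ` -/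

section Inaccessible

open Cardinal Ordinal

variable {κ : Cardinal.{u}}

theorem mk_lt_of_mem_vonNeumann (hκ : IsInaccessible κ) {x : ZFSet.{u}} (hx : x ∈ V_ κ.ord) :
    #x < Cardinal.lift.{u + 1} κ := by
  rw [ZFSet.cardinalMk_coe_sort, Cardinal.lift_lt]
  refine (ZFSet.card_mono (ZFSet.subset_vonNeumann_self x)).trans_lt ?_
  rw [ZFSet.card_vonNeumann]
  exact (preBeth_lt_preBeth.2 (ZFSet.mem_vonNeumann.1 hx)).trans_eq hκ.preBeth_ord

theorem mem_vonNeumann_of_mk_lt (hκ : IsInaccessible κ) {x : ZFSet.{u}} (hx : x ⊆ V_ κ.ord)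
    (hc : #x < Cardinal.lift.{u + 1} κ) : x ∈ V_ κ.ord := by
  obtain ⟨b, hb, h⟩ := exists_lt_ord_of_mk_lt hκ (S := ZFSet.rank '' (x : Set ZFSet))
    (by rintro _ ⟨y, hy, rfl⟩; exact ZFSet.mem_vonNeumann.1 (hx hy)) (mk_image_le.trans_lt hc)
  exact ZFSet.mem_vonNeumann.2 ((ZFSet.rank_le_iff.2 fun y hy => h _ ⟨y, hy, rfl⟩).trans_lt hb)

theorem model_ZFC_vonNeumann (hκ : IsInaccessible κ) : (V_ κ.ord : ZFSet.{u}) ⊨ ZFC := by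
  have hlim : Order.IsSuccLimit κ.ord := isSuccLimit_ord hκ.aleph0_lt.le
  have htr : ∀ {x y : ZFSet.{u}}, x ∈ y → y ∈ V_ κ.ord → x ∈ V_ κ.ord :=
    fun hxy hy => ZFSet.isTransitive_vonNeumann _ _ hy hxy
  have hext : ∀ x y : V_ κ.ord, (∀ z : V_ κ.ord, z.1 ∈ x.1 ↔ z.1 ∈ y.1) → x = y :=
    fun x y h => Subtype.ext <| ZFSet.ext fun z =>
      ⟨fun hz => (h ⟨z, htr hz x.2⟩).1 hz, fun hz => (h ⟨z, htr hz y.2⟩).2 hz⟩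
  refine Theory.model_iff _ |>.2 ?_
  rintro φ ((hφ | ⟨n, φ, rfl⟩) | ⟨n, φ, rfl⟩)
  · simp only [Set.mem_insert_iff, Set.mem_singleton_iff] at hφ
    rcases hφ with rfl | rfl | rfl | rfl | rfl | rfl | rfl
    · exact realize_axExtensionality.2 hext
    · refine realize_axFoundation.2 fun x ⟨y, hy⟩ => ?_
      obtain ⟨z, hz, hzx⟩ := ZFSet.regularity x.1 fun h => by simp [h] at hy
      refine ⟨⟨z, htr hz x.2⟩, hz, fun w hw hwx => ?_⟩
      have : w.1 ∈ x.1 ∩ z := ZFSet.mem_inter.2 ⟨hwx, hw⟩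
      simp [hzx] at this
    · refine realize_axPairing.2 fun x y => ⟨⟨{x.1, y.1}, ?_⟩, fun w => ?_⟩
      · have hx := ZFSet.mem_vonNeumann.1 x.2
        have hy := ZFSet.mem_vonNeumann.1 y.2
        rw [ZFSet.mem_vonNeumann, ZFSet.rank_pair]
        exact max_lt (hlim.succ_lt hx) (hlim.succ_lt hy)
      · simp only [ZFSet.mem_pair, Subtype.ext_iff]
    · refine realize_axUnion.2 fun x => ⟨⟨⋃₀ x.1, ?_⟩, fun z => ?_⟩
      · exact ZFSet.mem_vonNeumann.2
          ((ZFSet.rank_sUnion_le _).trans_lt (ZFSet.mem_vonNeumann.1 x.2))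
      · rw [ZFSet.mem_sUnion]
        exact ⟨fun ⟨w, hw, hz⟩ => ⟨⟨w, htr hw x.2⟩, hw, hz⟩, fun ⟨w, hw, hz⟩ => ⟨w, hw, hz⟩⟩
    · refine realize_axPowerSet.2 fun x => ⟨⟨x.1.powerset, ?_⟩, fun z => ?_⟩
      · rw [ZFSet.mem_vonNeumann, ZFSet.rank_powerset]
        exact hlim.succ_lt (ZFSet.mem_vonNeumann.1 x.2)
      · rw [ZFSet.mem_powerset]
        exact ⟨fun h w hw => h hw, fun h w hw => h ⟨w, htr hw z.2⟩ hw⟩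
    · have hω : (toZFSet ω : ZFSet.{u}) ∈ V_ κ.ord := by
        rw [ZFSet.mem_vonNeumann, rank_toZFSet, ← ord_aleph0]
        exact ord_lt_ord.2 hκ.aleph0_lt
      refine realize_axInfinity.2 ⟨⟨toZFSet ω, hω⟩, ⟨⟨∅, htr ?_ hω⟩, ?_, ?_⟩, fun y hy => ?_⟩
      · exact mem_toZFSet_iff.2 ⟨0, omega0_pos, toZFSet_zero⟩
      · exact mem_toZFSet_iff.2 ⟨0, omega0_pos, toZFSet_zero⟩
      · simp
      · obtain ⟨a, ha, hay⟩ := mem_toZFSet_iff.1 hy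
        have hs : toZFSet (a + 1) ∈ toZFSet ω :=
          toZFSet_mem_toZFSet_iff.2 (isSuccLimit_omega0.add_one_lt ha)
        refine ⟨⟨_, htr hs hω⟩, hs, fun w => ?_⟩
        simp only [toZFSet_add_one, hay, ZFSet.mem_insert_iff, Subtype.ext_iff]
        exact or_comm
    · refine realize_axChoice.2 fun x hne hdisj => ?_
      choose f hf using hne
      let c : ZFSet := ZFSet.sep (fun z => ∃ y, ∃ hy : y.1 ∈ x.1, z = (f y hy).1) (⋃₀ x.1)
      have hc : c ∈ V_ κ.ord := ZFSet.mem_vonNeumann.2 ((ZFSet.rank_mono ZFSet.sep_subset).trans_lt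
        ((ZFSet.rank_sUnion_le _).trans_lt (ZFSet.mem_vonNeumann.1 x.2)))
      refine ⟨⟨c, hc⟩, fun y hy => ⟨f y hy, fun w => ⟨fun ⟨hwy, hwc⟩ => ?_, ?_⟩⟩⟩
      · obtain ⟨-, y', hy', hw⟩ := ZFSet.mem_sep.1 (show w.1 ∈ c from hwc)
        have hwy' : w.1 ∈ y'.1 := hw ▸ hf y' hy'
        obtain rfl := hdisj y y' hy hy' ⟨w, hwy, hwy'⟩
        exact Subtype.ext hw
      · rintro rfl
        exact ⟨hf y hy, show _ ∈ c from
          ZFSet.mem_sep.2 ⟨ZFSet.mem_sUnion.2 ⟨y, hy, hf y hy⟩, y, hy, rfl⟩⟩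
  · refine model_axSeparation fun P a => ⟨⟨ZFSet.sep (fun z => ∃ h, P ⟨z, h⟩) a, ?_⟩, fun x => ?_⟩
    · exact ZFSet.mem_vonNeumann_of_subset ZFSet.sep_subset a.2
    · simp only [ZFSet.mem_sep]
      exact ⟨fun ⟨hx, _, hP⟩ => ⟨hx, hP⟩, fun ⟨hx, hP⟩ => ⟨hx, x.2, hP⟩⟩
  · refine model_axReplacement fun P a hP => ?_
    let b : ZFSet := ZFSet.sep (fun y => ∃ hy, ∃ x : V_ κ.ord, x.1 ∈ a.1 ∧ P x ⟨y, hy⟩) (V_ κ.ord)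
    have hb : ∀ y : b, ∃ x : a.1, ∃ hx hy, P ⟨x.1, hx⟩ ⟨y.1, hy⟩ := fun y => by
      obtain ⟨-, hy, x, hx, hPx⟩ := ZFSet.mem_sep.1 y.2
      exact ⟨⟨x.1, hx⟩, x.2, hy, hPx⟩
    -- Functionality of `P` makes this choice of preimages injective, so the image is no larger than
    -- `a`.
    choose g hg using hb
    have hg' : Function.Injective g := fun y z hyz => by
      obtain ⟨hx, hy, h⟩ := hg y
      obtain ⟨hx', hz, h'⟩ := hg z
      rw [← hyz] at hx'
      have h' : P ⟨(g y).1, hx⟩ ⟨z.1, hz⟩ := by simpa only [hyz] using h'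
      exact Subtype.ext (congr_arg (fun w : V_ κ.ord => w.1) (hP _ _ _ (g y).2 h h'))
    have hbV : b ∈ V_ κ.ord := mem_vonNeumann_of_mk_lt hκ ZFSet.sep_subset
      ((mk_le_of_injective hg').trans_lt (mk_lt_of_mem_vonNeumann hκ a.2))
    refine ⟨⟨b, hbV⟩, fun y => ?_⟩
    simp only [b, ZFSet.mem_sep]
    exact ⟨fun ⟨_, _, h⟩ => h, fun h => ⟨y.2, y.2, h⟩⟩

/-! ### Countability of the language, and models of ZFC below `κ`. -/

theorem setLang_card_le_aleph0 : setLang.card ≤ ℵ₀ := by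
  have hF : IsEmpty (Σ n, setLang.Functions n) := ⟨fun f => f.2.elim⟩
  have hR : ∀ n, Subsingleton (setLang.Relations n) := fun n =>
    ⟨fun a b => by cases a; cases b; rfl⟩
  have hR' : Countable (Σ n, setLang.Relations n) := inferInstance
  have : Countable setLang.Symbols :=
    inferInstanceAs (Countable ((Σ n, setLang.Functions n) ⊕ (Σ n, setLang.Relations n)))
  exact mk_le_aleph0

theorem countable_setLang_boundedFormula (α : Type) [Countable α] (n : ℕ) :
    Countable (setLang.BoundedFormula α n) := by
  have h : #(Σ n, setLang.BoundedFormula α n) ≤ ℵ₀ := by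
    refine BoundedFormula.card_le.trans (max_le le_rfl ?_)
    simpa using add_le_aleph0.2 ⟨mk_le_aleph0 (α := α), setLang_card_le_aleph0⟩
  have := mk_le_aleph0_iff.1 h
  exact Function.Injective.countable (f := fun φ => (⟨n, φ⟩ : Σ n, setLang.BoundedFormula α n))
    sigma_mk_injective

/-- The inclusion between classes of sets is an embedding. -/
def inclusionEmbedding {p q : ZFSet.{u} → Prop} (h : ∀ x, p x → q x) :
    Subtype p ↪[setLang] Subtype q where
  toFun x := ⟨x.1, h x.1 x.2⟩
  inj' x y hxy := Subtype.ext (Subtype.mk.inj hxy)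
  map_fun' f := f.elim
  map_rel' r x := by cases r; rfl

theorem mk_rank_le_lt (hκ : IsInaccessible κ) {x : Ordinal.{u}} (hx : x < κ.ord) :
    #{q : V_ κ.ord | q.1.rank ≤ x} < Cardinal.lift.{u + 1} κ := by
  have hlim : Order.IsSuccLimit κ.ord := isSuccLimit_ord hκ.aleph0_lt.le
  refine lt_of_le_of_lt ?_ (mk_lt_of_mem_vonNeumann hκ (x := V_ (Order.succ x))
    (ZFSet.vonNeumann_mem_of_lt (hlim.succ_lt hx)))
  exact mk_le_of_injective
    (f := fun q => ⟨q.1.1, ZFSet.mem_vonNeumann.2 (Order.lt_succ_of_le q.2)⟩)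
    fun a b hab => Subtype.ext (Subtype.ext (Subtype.mk.inj hab))

/-- Positivity of `a` is for the empty tuple, whose rank is `0`. -/
theorem tupleRank_lt_iff {K : ℕ → Type} {Q : Type*} {r : Q → Ordinal.{u}}
    {p : Σ n, K n × (Fin n → Q)} {a : Ordinal.{u}} (ha : 0 < a) :
    tupleRank r p < a ↔ ∀ i, r (p.2.2 i) < a := by
  simp [tupleRank, Finset.sup_lt_iff (show ⊥ < a from ha)]

/-- There are club many `θ < κ` such that `V_θ` is a model of ZFC. -/
theorem exists_isClub_model_ZFC (hκ : IsInaccessible κ) :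
    ∃ D : Set (Set.Iio κ.ord), IsClub D ∧ ∀ θ ∈ D, (V_ θ.1 : ZFSet.{u}) ⊨ ZFC := by
  classical
  let P := Σ n, setLang.BoundedFormula Empty (n + 1) × (Fin n → V_ κ.ord)
  -- `o` is the rank of a witness, or `0` if there is none. Closure of `θ` under these ranks gives
  -- the Tarski–Vaught test for `V_θ` in `V_κ`.
  have hw : ∀ p : P, ∃ o < κ.ord, (∃ a, p.2.1.Realize default (Fin.snoc p.2.2 a)) →
      ∃ a : V_ κ.ord, p.2.1.Realize default (Fin.snoc p.2.2 a) ∧ a.1.rank = o := by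
    intro p
    by_cases h : ∃ a, p.2.1.Realize default (Fin.snoc p.2.2 a)
    · obtain ⟨a, ha⟩ := h
      exact ⟨a.1.rank, ZFSet.mem_vonNeumann.1 a.2, fun _ => ⟨a, ha, rfl⟩⟩
    · exact ⟨0, (isSuccLimit_ord hκ.aleph0_lt.le).bot_lt, fun h' => (h h').elim⟩
  choose e he hw using hw
  have := fun n => countable_setLang_boundedFormula Empty (n + 1)
  have hclub := isClub_closurePoints hκ (P := P) (tupleRank fun q : V_ κ.ord => q.1.rank) e he
    fun x hx => mk_tupleRank_le_lt _ x hκ.aleph0_lt (mk_rank_le_lt hκ hx)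
  have h1 : 1 < κ.ord := by
    rw [← ord_one]; exact ord_lt_ord.2 (one_lt_aleph0.trans hκ.aleph0_lt)
  refine ⟨_, hclub.inter (cof_Iio_ord_ne_aleph0 hκ) (isClub_Ici ⟨1, h1⟩), fun θ hθ => ?_⟩
  have hθ0 : 0 < θ.1 := zero_lt_one.trans_le (show (1 : Ordinal) ≤ θ.1 from hθ.2)
  let f : (V_ θ.1 : ZFSet.{u}) ↪[setLang] (V_ κ.ord : ZFSet.{u}) :=
    inclusionEmbedding fun x hx => ZFSet.vonNeumann_subset_of_le θ.2.le hx
  refine ((f.toElementaryEmbedding fun n φ x a hφ => ?_).theory_model_iff ZFC).2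
    (model_ZFC_vonNeumann hκ)
  obtain ⟨b, hb, hbr⟩ := hw ⟨n, φ, f ∘ x⟩ ⟨a, hφ⟩
  have hlt := hθ.1 ⟨n, φ, f ∘ x⟩ ((tupleRank_lt_iff hθ0).2 fun i =>
    ZFSet.mem_vonNeumann.1 (x i).2)
  rw [← hbr] at hlt
  exact ⟨⟨b.1, ZFSet.mem_vonNeumann.2 hlt⟩, hb⟩

end Inaccessible

/-! ### The Mostow collapse of an elementary substructure -/

section Collapse

/-- The Mostow collapse of the class `X`. -/
noncomputable def collapse (X : Set ZFSet.{u}) (x : ZFSet.{u}) : ZFSet.{u} :=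
  ZFSet.range fun y : {y : x // y.1 ∈ X} => collapse X y.1.1
termination_by x
decreasing_by exact y.1.2

variable {X : Set ZFSet.{u}}

theorem mem_collapse {x z : ZFSet.{u}} :
    z ∈ collapse X x ↔ ∃ y ∈ x, y ∈ X ∧ collapse X y = z := by
  rw [collapse, ZFSet.mem_range]
  exact ⟨fun ⟨y, hy⟩ => ⟨y.1.1, y.1.2, y.2, hy⟩, fun ⟨y, hyx, hyX, hy⟩ => ⟨⟨⟨y, hyx⟩, hyX⟩, hy⟩⟩

theorem rank_collapse_le (x : ZFSet.{u}) : (collapse X x).rank ≤ x.rank := by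
  induction x using ZFSet.inductionOn with
  | h x ih =>
    refine ZFSet.rank_le_iff.2 fun z hz => ?_
    obtain ⟨y, hyx, -, rfl⟩ := mem_collapse.1 hz
    exact (ih y hyx).trans_lt (ZFSet.rank_lt_of_mem hyx)

theorem collapse_eq_self {Y : ZFSet.{u}} (hY : Y.IsTransitive) (hYX : ∀ y ∈ Y, y ∈ X) :
    ∀ y ∈ Y, collapse X y = y := by
  intro y
  induction y using ZFSet.inductionOn with
  | h y ih =>
    intro hy
    ext z
    rw [mem_collapse]
    constructor
    · rintro ⟨w, hw, -, rfl⟩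
      rwa [ih w hw (hY y hy hw)]
    · exact fun hz => ⟨z, hz, hYX z (hY y hy hz), ih z hz (hY y hy hz)⟩

theorem collapse_injOn (hX : ∀ x ∈ X, ∀ y ∈ X, (∀ z ∈ X, z ∈ x ↔ z ∈ y) → x = y) :
    Set.InjOn (collapse X) X := by
  intro x
  induction x using ZFSet.inductionOn with
  | h x ih =>
    intro hx y hy hxy
    refine hX x hx y hy fun z hz => ⟨fun hzx => ?_, fun hzy => ?_⟩
    · have : collapse X z ∈ collapse X y := hxy ▸ mem_collapse.2 ⟨z, hzx, hz, rfl⟩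
      obtain ⟨w, hwy, hw, hwz⟩ := mem_collapse.1 this
      rwa [ih z hzx hz hw hwz.symm]
    · have : collapse X z ∈ collapse X x := hxy ▸ mem_collapse.2 ⟨z, hzy, hz, rfl⟩
      obtain ⟨w, hwx, hw, hwz⟩ := mem_collapse.1 this
      rwa [← ih w hwx hw hz hwz]

theorem collapse_mem_collapse_iff
    (hX : ∀ x ∈ X, ∀ y ∈ X, (∀ z ∈ X, z ∈ x ↔ z ∈ y) → x = y) {x y : ZFSet.{u}} (hy : y ∈ X) :
    collapse X y ∈ collapse X x ↔ y ∈ x := by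
  rw [mem_collapse]
  constructor
  · rintro ⟨w, hwx, hw, hwy⟩
    rwa [← collapse_injOn hX hw hy hwy]
  · exact fun h => ⟨y, h, hy, rfl⟩

/-- Elementarity hands Extensionality of `T` down to `S`, so the collapse is an isomorphism; `i` is
its inverse. The collapse does not raise ranks and fixes transitive sets included in `S`. -/
theorem exists_collapse {T : ZFSet.{u}} (hT : T ⊨ ZFC) (S : setLang.ElementarySubstructure T) :
    ∃ (M : ZFSet.{u}) (i : M ↪ₑ[setLang] T), M.IsTransitive ∧ (∀ x ∈ M, x.rank < T.rank) ∧
      (∀ m, i m ∈ S) ∧ ∀ Y : ZFSet.{u}, Y.IsTransitive → (∀ y ∈ Y, ∃ h : y ∈ T, ⟨y, h⟩ ∈ S) →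
        ∀ y ∈ Y, ∃ h : y ∈ M, (i ⟨y, h⟩).1 = y := by
  let X : Set ZFSet.{u} := {x | ∃ h : x ∈ T, (⟨x, h⟩ : T) ∈ S}
  have hSX : ∀ s : S, s.1.1 ∈ X := fun s => ⟨s.1.2, s.2⟩
  have hX : ∀ x ∈ X, ∀ y ∈ X, (∀ z ∈ X, z ∈ x ↔ z ∈ y) → x = y := by
    rintro x ⟨hxT, hx⟩ y ⟨hyT, hy⟩ hxy
    let φ : setLang.BoundedFormula Empty 2 := ∀' (memF 3 2 0 ⇔ memF 3 2 1)
    let v : Fin 2 → S := ![⟨⟨x, hxT⟩, hx⟩, ⟨⟨y, hyT⟩, hy⟩]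
    have hφ : φ.Realize default v := by
      simp only [φ, BoundedFormula.realize_all, BoundedFormula.realize_iff]
      exact fun z => hxy z.1.1 (hSX z)
    rw [← S.subtype.map_boundedFormula] at hφ
    have hφ : ∀ z : T, z.1 ∈ x ↔ z.1 ∈ y := by
      simpa [φ, v, Fin.snoc] using hφ
    have hext := realize_axExtensionality.1 (Theory.realize_sentence_of_mem (M := T) ZFC
      (φ := axExtensionality) (by simp [ZFC]))
    exact congr_arg Subtype.val (hext ⟨x, hxT⟩ ⟨y, hyT⟩ hφ)
  have : Small.{u} S := small_of_injective (f := fun s : S => (s.1 : T)) Subtype.val_injective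
  let M : ZFSet.{u} := ZFSet.range fun s : S => collapse X s.1.1
  let F : S → M := fun s => ⟨collapse X s.1.1, ZFSet.mem_range.2 ⟨s, rfl⟩⟩
  have hF : Function.Bijective F := by
    refine ⟨fun s t hst => ?_, fun m => ?_⟩
    · exact Subtype.ext (Subtype.ext (collapse_injOn hX (hSX s) (hSX t) (Subtype.mk.inj hst)))
    · obtain ⟨s, hs⟩ := ZFSet.mem_range.1 m.2
      exact ⟨s, Subtype.ext hs⟩
  let e : S ≃[setLang] M :=
    { Equiv.ofBijective F hF with
      map_fun' := fun f => f.elim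
      map_rel' := fun r x => by
        cases r
        exact collapse_mem_collapse_iff hX (hSX (x 0)) }
  let i : M ↪ₑ[setLang] T := S.subtype.comp e.symm.toElementaryEmbedding
  refine ⟨M, i, ?_, ?_, fun m => (e.symm m).2, fun Y hY hYS y hy => ?_⟩
  · intro x hx z hz
    obtain ⟨s, rfl⟩ := ZFSet.mem_range.1 hx
    obtain ⟨w, -, ⟨hwT, hw⟩, rfl⟩ := mem_collapse.1 hz
    exact ZFSet.mem_range.2 ⟨⟨⟨w, hwT⟩, hw⟩, rfl⟩
  · intro x hx
    obtain ⟨s, rfl⟩ := ZFSet.mem_range.1 hx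
    exact (rank_collapse_le _).trans_lt (ZFSet.rank_lt_of_mem s.1.2)
  · obtain ⟨hyT, hyS⟩ := hYS y hy
    have hc : collapse X y = y := collapse_eq_self hY hYS y hy
    have hyM : y ∈ M := ZFSet.mem_range.2 ⟨⟨⟨y, hyT⟩, hyS⟩, hc⟩
    refine ⟨hyM, ?_⟩
    have : e.symm ⟨y, hyM⟩ = ⟨⟨y, hyT⟩, hyS⟩ := by
      rw [← e.symm_apply_apply ⟨⟨y, hyT⟩, hyS⟩]
      exact congr_arg e.symm (Subtype.ext hc.symm)
    exact congr_arg (fun s : S => s.1.1) this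

end Collapse

/-! ### Extremely reflective cardinals below the least `ω`-Erdős cardinal -/

section Reflection

open Cardinal Ordinal

variable {κ : Cardinal.{u}}

/-- Names are tagged so that they mean the same for every `a`: tag 0 names an element of `V_a` by
itself, tag 1 enumerates the substructure by `V_a`, tag 2 names `a`. Indexing by `V_κ` makes the set
of names independent of `a`; names outside `V_a` get the dummy value `a`. -/
theorem exists_enumerated_collapse {a θ : Ordinal.{u}} (hω : ω ≤ a)
    (haθ : a < θ) (hθκ : θ < κ.ord) (hθ : (V_ θ : ZFSet.{u}) ⊨ ZFC) :
    ∃ (M : ZFSet.{u}) (i : M ↪ₑ[setLang] (V_ θ : ZFSet.{u}))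
      (x : Fin 3 × (V_ κ.ord : ZFSet.{u}) → (V_ θ : ZFSet.{u})),
      M.IsTransitive ∧ (∀ m ∈ M, m.rank < θ) ∧
      (∀ y ∈ (insert (V_ a) (insert a.toZFSet (V_ a)) : ZFSet.{u}),
        ∃ h : y ∈ M, (i ⟨y, h⟩).1 = y) ∧
      (∀ m, ∃ q, q.2.1.rank < a ∧ x q = i m) ∧
      (∀ p : V_ κ.ord, p.1 ∈ V_ a → (x (0, p)).1 = p.1) ∧
      ∀ p : V_ κ.ord, (x (2, p)).1 = a.toZFSet := by
  classical
  set Y : ZFSet.{u} := insert (V_ a) (insert a.toZFSet (V_ a)) with hYdef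
  have hYT : ∀ y ∈ Y, y ∈ V_ θ := by
    intro y hy
    rw [ZFSet.mem_vonNeumann]
    simp only [hYdef, ZFSet.mem_insert_iff, ZFSet.mem_vonNeumann] at hy
    rcases hy with rfl | rfl | hy
    · rwa [ZFSet.rank_vonNeumann]
    · rwa [rank_toZFSet]
    · exact hy.trans haθ
  have haV : a.toZFSet ∈ V_ θ := hYT _ (by simp [hYdef])
  have hYtr : Y.IsTransitive := by
    intro y hy z hz
    simp only [hYdef, ZFSet.mem_insert_iff] at hy ⊢
    refine .inr (.inr ?_)
    rcases hy with rfl | rfl | hy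
    · exact hz
    · exact toZFSet_subset_vonNeumann a hz
    · exact ZFSet.isTransitive_vonNeumann a y hy hz
  have hinf : ℵ₀ ≤ (V_ a : ZFSet.{u}).card :=
    (aleph0_le_card.2 hω).trans a.card_le_card_vonNeumann
  have hYc : Y.card ≤ (V_ a : ZFSet.{u}).card := by
    refine (ZFSet.card_insert_le.trans (add_le_add_left ZFSet.card_insert_le 1)).trans ?_
    rw [add_one_eq hinf, add_one_eq hinf]
  obtain ⟨S, hsS, hSc⟩ := exists_elementarySubstructure_card_eq setLang
    (M := (V_ θ : ZFSet.{u})) {z | z.1 ∈ Y} #(V_ a : ZFSet.{u})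
    (by rw [ZFSet.cardinalMk_coe_sort]; exact aleph0_le_lift.2 hinf)
    (by
      rw [Cardinal.lift_le]
      refine (mk_le_of_injective (β := Y) (f := fun z => ⟨z.1.1, z.2⟩) fun z w hzw =>
        Subtype.ext (Subtype.ext (Subtype.mk.inj hzw))).trans ?_
      rw [ZFSet.cardinalMk_coe_sort, ZFSet.cardinalMk_coe_sort]
      exact Cardinal.lift_le.2 hYc)
    (by
      rw [ZFSet.cardinalMk_coe_sort, Cardinal.lift_lift]
      refine (lift_le_aleph0.2 setLang_card_le_aleph0).trans ?_
      exact aleph0_le_lift.2 hinf)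
    (by
      rw [Cardinal.lift_le]
      exact mk_le_of_injective
        (f := fun z => ⟨z.1, ZFSet.vonNeumann_subset_of_le haθ.le z.2⟩) fun z w hzw =>
          Subtype.ext (Subtype.mk.inj hzw))
  rw [Cardinal.lift_inj] at hSc
  obtain ⟨e⟩ := Cardinal.eq.1 hSc.symm
  obtain ⟨M, i, hMtr, hMr, hiS, hi⟩ := exists_collapse hθ S
  let d : (V_ θ : ZFSet.{u}) := ⟨a.toZFSet, haV⟩
  let x : Fin 3 × (V_ κ.ord : ZFSet.{u}) → (V_ θ : ZFSet.{u}) := fun q =>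
    if h : q.2.1 ∈ V_ a then
      match q.1 with
      | 0 => ⟨q.2.1, ZFSet.vonNeumann_subset_of_le haθ.le h⟩
      | 1 => (e ⟨q.2.1, h⟩).1
      | 2 => d
    else d
  refine ⟨M, i, x, hMtr, fun m hm => by simpa using hMr m hm,
    hi Y hYtr fun y hy => ⟨hYT y hy, hsS hy⟩, fun m => ?_, fun p hp => by simp [x, hp], fun p => ?_⟩
  · let p := e.symm ⟨i m, hiS m⟩
    have hpκ : p.1 ∈ V_ κ.ord := ZFSet.vonNeumann_subset_of_le (haθ.trans hθκ).le p.2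
    refine ⟨(1, ⟨p.1, hpκ⟩), ZFSet.mem_vonNeumann.1 p.2, ?_⟩
    have : e p = ⟨i m, hiS m⟩ := e.apply_symm_apply _
    have hp : p.1 ∈ V_ a := p.2
    simp [x, hp, this]
  · by_cases hp : p.1 ∈ V_ a <;> simp [x, hp, d]

theorem isCardinalIn_of_ord_card_eq (W : Set ZFSet.{u}) {a : Ordinal.{u}} (ha : a.card.ord = a) :
    IsCardinalIn W a := by
  rintro μ hμ f - ⟨⟨hsub, huniq⟩, hsurj⟩
  have hs : ∀ y : a.toZFSet, ∃ x : μ.toZFSet, ZFSet.pair x.1 y.1 ∈ f := fun y => by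
    obtain ⟨x, hx, hxy⟩ := hsurj y.1 y.2
    exact ⟨⟨x, hx⟩, hxy⟩
  choose g hg using hs
  have hinj : Function.Injective g := fun y z hyz => by
    have h := hg z
    rw [← hyz] at h
    exact Subtype.ext ((huniq _ (g y).2).unique (hg y) h)
  have hle := mk_le_of_injective hinj
  rw [ZFSet.cardinalMk_coe_sort, ZFSet.cardinalMk_coe_sort, Cardinal.lift_le, card_toZFSet,
    card_toZFSet] at hle
  rw [← ha, lt_ord] at hμ
  exact hle.not_gt hμ

theorem isClub_ord_card_eq (hκ : IsInaccessible κ) :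
    IsClub {a : Set.Iio κ.ord | ∀ ξ : Set.Iio κ.ord, ξ.1 < a.1 →
      (Order.succ ξ.1.card).ord < a.1} := by
  have hlim : Order.IsSuccLimit κ.ord := isSuccLimit_ord hκ.aleph0_lt.le
  refine isClub_closurePoints hκ _ _ (fun ξ => ?_) fun x hx => ?_
  · exact ord_lt_ord.2 (hκ.isSuccLimit.succ_lt (lt_ord.1 ξ.2))
  · have : Cardinal.lift.{u + 1} (Order.succ x).card < Cardinal.lift.{u + 1} κ :=
      Cardinal.lift_lt.2 (lt_ord.1 (hlim.succ_lt hx))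
    refine lt_of_le_of_lt ?_ this
    rw [← Cardinal.mk_Iio_ordinal]
    exact mk_le_of_injective (f := fun ξ => ⟨ξ.1.1, Set.mem_Iio.2 (Order.lt_succ_of_le ξ.2)⟩) fun ξ η h =>
      Subtype.ext (Subtype.ext (Subtype.mk.inj h))

theorem ord_card_eq_of_forall {a : Set.Iio κ.ord}
    (h : ∀ ξ : Set.Iio κ.ord, ξ.1 < a.1 → (Order.succ ξ.1.card).ord < a.1) :
    a.1.card.ord = a.1 := by
  refine (ord_card_le a.1).antisymm (not_lt.1 fun hlt => ?_)
  have := h ⟨a.1.card.ord, hlt.trans a.2⟩ hlt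
  rw [card_ord] at this
  exact (Order.lt_succ _).not_ge (ord_le.1 this.le)

theorem rank_pair_lt {x y : ZFSet.{u}} {o : Ordinal.{u}} (ho : Order.IsSuccLimit o)
    (hx : x.rank < o) (hy : y.rank < o) : (ZFSet.pair x y).rank < o := by
  rw [ZFSet.pair, ZFSet.rank_pair, ZFSet.rank_pair, ZFSet.rank_singleton]
  exact max_lt (ho.succ_lt (ho.succ_lt hx))
    (ho.succ_lt (max_lt (ho.succ_lt hx) (ho.succ_lt hy)))

/-- The conclusion of extreme reflection for the parameter `s`, relativized to `W`. -/
def ReflectsIn (W : Set ZFSet.{u}) (κ : Ordinal.{u}) (s : ZFSet.{u}) : Prop :=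
  ∃ lam < κ, ∃ M ∈ W, ∃ N ∈ W, ∃ g ∈ W,
    M.IsTransitive ∧ N.IsTransitive ∧ M ⊨ ZFC ∧ N ⊨ ZFC ∧
    V_ lam ⊆ M ∧ V_ lam ∈ M ∧ s ∈ N ∧
    ∃ j : M ↪ₑ[setLang] N,
      (∀ z, z ∈ g ↔ ∃ x : M, z = ZFSet.pair x.1 (j x).1) ∧
      IsCriticalPoint j lam ∧
      ∀ x : M, x.1 = lam.toZFSet → (j x).1 = κ.toZFSet

theorem exists_code (hκ : IsInaccessible κ) :
    ∃ e : (Σ n, setLang.Formula (Fin n) × (Fin n → Fin 3 × (V_ κ.ord : ZFSet.{u}))) →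
      Set.Iio κ.ord, Function.Injective e := by
  have hκ' : ℵ₀ ≤ Cardinal.lift.{u + 1} κ := aleph0_le_lift.2 hκ.aleph0_lt.le
  have := fun n => countable_setLang_boundedFormula (Fin n) 0
  have h : #(Σ n, setLang.Formula (Fin n) × (Fin n → Fin 3 × (V_ κ.ord : ZFSet.{u}))) ≤
      #(Set.Iio κ.ord) := by
    rw [Cardinal.mk_Iio_ordinal, card_ord]
    refine (mk_sigma_tuples_le (K := fun n => setLang.BoundedFormula (Fin n) 0) _).trans
      (max_le hκ' ?_)
    rw [mk_prod]
    refine (mul_le_max _ _).trans (max_le (max_le ?_ ?_) hκ')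
    · exact (lift_le_aleph0.2 mk_le_aleph0).trans hκ'
    · rw [ZFSet.cardinalMk_coe_sort, ZFSet.card_vonNeumann, hκ.preBeth_ord]
      simp
  obtain ⟨e⟩ := h
  exact ⟨e, e.injective⟩

theorem mk_rank_snd_le_lt (hκ : IsInaccessible κ) {x : Ordinal.{u}} (hx : x < κ.ord) :
    #{q : Fin 3 × (V_ κ.ord : ZFSet.{u}) | q.2.1.rank ≤ x} < Cardinal.lift.{u + 1} κ := by
  have hκ' : ℵ₀ < Cardinal.lift.{u + 1} κ := aleph0_lt_lift.2 hκ.aleph0_lt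
  refine lt_of_le_of_lt (mk_le_of_injective
    (β := Fin 3 × {q : V_ κ.ord | q.1.rank ≤ x}) (f := fun q => (q.1.1, ⟨q.1.2, q.2⟩))
    fun p q h => ?_) ?_
  · simp only [Prod.mk.injEq, Subtype.mk.injEq] at h
    exact Subtype.ext (Prod.ext h.1 h.2)
  · rw [mk_prod]
    refine mul_lt_of_lt hκ'.le ((lift_le_aleph0.2 mk_le_aleph0).trans_lt hκ') ?_
    simpa using mk_rank_le_lt hκ hx

/-- Two enumerated collapses that satisfy the same formulas yield an elementary embedding with
critical point `a` that sends `a` to `b`. -/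
theorem reflectsIn_of_realize_iff (hκ : IsInaccessible κ) {a b θ η : Ordinal.{u}} (h0a : 0 < a)
    (hab : a < b) (haθ : a < θ) (hθκ : θ < κ.ord) (hηκ : η < κ.ord)
    (hθ : (V_ θ : ZFSet.{u}) ⊨ ZFC) (hη : (V_ η : ZFSet.{u}) ⊨ ZFC)
    {M : ZFSet.{u}} (i : M ↪ₑ[setLang] (V_ θ : ZFSet.{u}))
    (x : Fin 3 × (V_ κ.ord : ZFSet.{u}) → (V_ θ : ZFSet.{u}))
    (y : Fin 3 × (V_ κ.ord : ZFSet.{u}) → (V_ η : ZFSet.{u}))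
    (hM : M.IsTransitive) (hMr : ∀ m ∈ M, m.rank < θ)
    (hi : ∀ y ∈ (insert (V_ a) (insert a.toZFSet (V_ a)) : ZFSet.{u}),
        ∃ h : y ∈ M, (i ⟨y, h⟩).1 = y)
    (hx : ∀ m, ∃ q, q.2.1.rank < a ∧ x q = i m)
    (hx0 : ∀ p : V_ κ.ord, p.1 ∈ V_ a → (x (0, p)).1 = p.1)
    (hx2 : ∀ p : V_ κ.ord, (x (2, p)).1 = a.toZFSet)
    (hy0 : ∀ p : V_ κ.ord, p.1 ∈ V_ b → (y (0, p)).1 = p.1)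
    (hy2 : ∀ p : V_ κ.ord, (y (2, p)).1 = b.toZFSet)
    (hxy : ∀ (n : ℕ) (φ : setLang.Formula (Fin n)) (q : Fin n → Fin 3 × (V_ κ.ord : ZFSet.{u})),
      (∀ k, (q k).2.1.rank < a) → (φ.Realize (x ∘ q) ↔ φ.Realize (y ∘ q)))
    {s : ZFSet.{u}} (hs : s.rank < η) : ReflectsIn {x | x ∈ V_ κ.ord} b s := by
  have hlim : Order.IsSuccLimit κ.ord := isSuccLimit_ord hκ.aleph0_lt.le
  choose q hqr hq using hx
  -- Send an element to the value of its name at `b`; agreement on formulas makes this elementary.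
  let j : M ↪ₑ[setLang] (V_ η : ZFSet.{u}) :=
    { toFun := fun m => y (q m)
      map_formula' := fun n φ v => by
        have h := hxy n φ (q ∘ v) fun k => hqr _
        have e1 : x ∘ q ∘ v = i ∘ v := funext fun k => hq _
        rw [e1, i.map_formula] at h
        exact h.symm }
  -- Agreement on the formula "the two named elements are equal" makes the image independent of the
  -- name.
  have hj : ∀ m q', q'.2.1.rank < a → x q' = i m → j m = y q' := by
    intro m q' hq' hm
    have h := hxy 2 ((Term.var 0).equal (Term.var 1)) ![q m, q'] fun k => by
      fin_cases k
      · exact hqr m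
      · exact hq'
    simp only [Formula.realize_equal, Term.realize_var, Function.comp_apply,
      Matrix.cons_val_zero, Matrix.cons_val_one] at h
    exact h.1 ((hq m).trans hm.symm)
  have hjV : ∀ m : M, m.1 ∈ V_ a → (j m).1 = m.1 := by
    intro m hm
    have hmκ : m.1 ∈ V_ κ.ord := ZFSet.vonNeumann_subset_of_le (haθ.trans hθκ).le hm
    obtain ⟨h, him⟩ := hi m.1 (by simp [hm])
    rw [hj m (0, ⟨m.1, hmκ⟩) (ZFSet.mem_vonNeumann.1 hm)
      (Subtype.ext ((hx0 _ hm).trans him.symm))]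
    exact hy0 _ (ZFSet.vonNeumann_subset_of_le hab.le hm)
  have hja : ∀ m : M, m.1 = a.toZFSet → (j m).1 = b.toZFSet := by
    intro m hm
    obtain ⟨h, him⟩ := hi m.1 (by simp [hm])
    have h0 : (∅ : ZFSet.{u}) ∈ V_ κ.ord := by
      rw [ZFSet.mem_vonNeumann, ZFSet.rank_empty]
      exact hlim.bot_lt
    rw [hj m (2, ⟨∅, h0⟩) (by simpa using h0a)
      (Subtype.ext ((hx2 _).trans (hm.symm.trans him.symm)))]
    exact hy2 _
  have hMκ : M ∈ V_ κ.ord :=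
    ZFSet.mem_vonNeumann.2 ((ZFSet.rank_le_iff.2 hMr).trans_lt hθκ)
  let g : ZFSet.{u} := ZFSet.range fun m : M => ZFSet.pair m.1 (j m).1
  have hgκ : g ∈ V_ κ.ord := by
    refine mem_vonNeumann_of_mk_lt hκ (fun z hz => ?_) ?_
    · obtain ⟨m, rfl⟩ := ZFSet.mem_range.1 hz
      exact ZFSet.mem_vonNeumann.2 (rank_pair_lt hlim ((hMr _ m.2).trans hθκ)
        ((ZFSet.mem_vonNeumann.1 (j m).2).trans hηκ))
    · refine lt_of_le_of_lt ?_ (mk_lt_of_mem_vonNeumann hκ hMκ)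
      refine mk_le_of_surjective
        (f := fun m : M => (⟨ZFSet.pair m.1 (j m).1, ZFSet.mem_range.2 ⟨m, rfl⟩⟩ : g)) fun z => ?_
      obtain ⟨m, hm⟩ := ZFSet.mem_range.1 z.2
      exact ⟨m, Subtype.ext hm⟩
  refine ⟨a, hab, M, hMκ, V_ η, ZFSet.vonNeumann_mem_of_lt hηκ, g, hgκ, hM,
    ZFSet.isTransitive_vonNeumann η, (i.theory_model_iff ZFC).2 hθ, hη,
    fun z hz => (hi z (by simp [hz])).1, (hi _ (by simp)).1, ZFSet.mem_vonNeumann.2 hs, j,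
    fun z => ?_, ⟨fun m hm => hjV m (toZFSet_subset_vonNeumann a hm), ?_⟩, hja⟩
  · rw [ZFSet.mem_range]
    exact ⟨fun ⟨m, hm⟩ => ⟨m, hm.symm⟩, fun ⟨m, hm⟩ => ⟨m, hm.symm⟩⟩
  · obtain ⟨h, -⟩ := hi a.toZFSet (by simp)
    refine ⟨⟨_, h⟩, rfl, ?_⟩
    rw [hja _ rfl]
    exact fun h => hab.ne' (toZFSet_injective h)

theorem isStationary_isExtremelyReflectiveIn
    (hκ : IsLeast {μ : Cardinal.{u} | IsOmegaErdos μ} κ) :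
    IsStationary {α : Set.Iio κ.ord |
        IsExtremelyReflectiveIn {x | x ∈ V_ κ.ord} α.1} := by
  have hi := isInaccessible_of_isLeast hκ
  have hlim : Order.IsSuccLimit κ.ord := isSuccLimit_ord hi.aleph0_lt.le
  have hcof := cof_Iio_ord_ne_aleph0 hi
  intro C hC
  by_contra hempty
  obtain ⟨D, hD, hDZ⟩ := exists_isClub_model_ZFC hi
  obtain ⟨e, he⟩ := exists_code hi
  have := fun n => countable_setLang_boundedFormula (Fin n) 0
  have hcode := isClub_closurePoints hi (tupleRank fun q : Fin 3 × V_ κ.ord => q.2.1.rank)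
    (fun p => (e p).1) (fun p => (e p).2) fun x hx =>
      mk_tupleRank_le_lt (K := fun n => setLang.Formula (Fin n)) _ x hi.aleph0_lt
        (mk_rank_snd_le_lt hi hx)
  have hω : ω < κ.ord := by rw [← ord_aleph0]; exact ord_lt_ord.2 hi.aleph0_lt
  have hC' := (hC.inter hcof (isClub_ord_card_eq hi)).inter hcof
    (hcode.inter hcof (isClub_Ici ⟨ω, hω⟩))
  -- If every parameter reflected at a cardinal `a` in `C`, then `a` would be an extremely
  -- reflective member of `C`. Elsewhere `s` is arbitrary.
  have hbad : ∀ a : Set.Iio κ.ord, ∃ s ∈ V_ κ.ord, a ∈ C → a.1.card.ord = a.1 →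
      ¬ ReflectsIn {x | x ∈ V_ κ.ord} a.1 s := by
    intro a
    by_contra! h
    obtain ⟨haC, ha, -⟩ := h ∅ (by
      rw [ZFSet.mem_vonNeumann, ZFSet.rank_empty]; exact hlim.bot_lt)
    refine hempty ⟨a, ⟨?_, isCardinalIn_of_ord_card_eq _ ha, fun s hs => (h s hs).2.2⟩, haC⟩
    exact ZFSet.mem_vonNeumann.2 (by rw [rank_toZFSet]; exact a.2)
  choose s hsV hs using hbad
  have hθ : ∀ a : Set.Iio κ.ord, ∃ θ ∈ D, a.1 < θ.1 ∧ (s a).rank < θ.1 := by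
    intro a
    obtain ⟨θ, hθ, hle⟩ := hD.isCofinal ⟨max (Order.succ a.1) (Order.succ (s a).rank),
      max_lt (hlim.succ_lt a.2) (hlim.succ_lt (ZFSet.mem_vonNeumann.1 (hsV a)))⟩
    replace hle : max (Order.succ a.1) (Order.succ (s a).rank) ≤ θ.1 := hle
    exact ⟨θ, hθ, (Order.lt_succ _).trans_le ((le_max_left _ _).trans hle),
      (Order.lt_succ _).trans_le ((le_max_right _ _).trans hle)⟩
  choose θ hθD hθa hθs using hθ
  choose M i x hMtr hMr hfix hx hx0 hx2 using fun (a : Set.Iio κ.ord) (ha : ω ≤ a.1) =>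
    exists_enumerated_collapse ha (hθa a) (θ a).2 (hDZ _ (hθD a))
  obtain ⟨a, ⟨⟨haC, hac⟩, hae, haω⟩, b, ⟨⟨hbC, hbc⟩, hbe, hbω⟩, hab, hAB⟩ :=
    -- The set at `a` codes the formulas with names that hold in `V_(θ a)`. Closure of `a` under `e`
    -- puts codes of formulas whose names have rank below `a` under `a`, where the two sets agree.
    exists_coherent_pair_Iio_ord hκ hC' fun a =>
      {c | ∃ (ha : ω ≤ a.1) (p : _), e p = c ∧ p.2.1.Realize (x a ha ∘ p.2.2)}
  refine hs b hbC (ord_card_eq_of_forall hbc) ?_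
  refine reflectsIn_of_realize_iff hi (omega0_pos.trans_le haω) hab (hθa a) (θ a).2 (θ b).2
    (hDZ _ (hθD a)) (hDZ _ (hθD b)) (i a haω) (x a haω) (x b hbω) (hMtr a haω) (hMr a haω) (hfix a haω)
    (hx a haω) (hx0 a haω) (hx2 a haω) (hx0 b hbω) (hx2 b hbω) (fun n φ q hq => ?_) (hθs b)
  have hlt : e ⟨n, φ, q⟩ < a := hae ⟨n, φ, q⟩
    ((tupleRank_lt_iff (omega0_pos.trans_le haω)).2 hq)
  have key : ∀ (c : Set.Iio κ.ord) (hc : ω ≤ c.1),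
      (∃ (hc : ω ≤ c.1) (p : _), e p = e ⟨n, φ, q⟩ ∧ p.2.1.Realize (x c hc ∘ p.2.2)) ↔
        φ.Realize (x c hc ∘ q) := by
    intro c hc
    constructor
    · rintro ⟨_, p, hp, h⟩
      obtain rfl := he hp
      exact h
    · exact fun h => ⟨hc, _, rfl, h⟩
  rw [← key a haω, ← key b hbω]
  exact hAB _ hlt

theorem properClass_of_isStationary
    (h : IsStationary {α : Set.Iio κ.ord | IsExtremelyReflectiveIn {x | x ∈ V_ κ.ord} α.1}) :
    ProperClassOfExtremelyReflective {x | x ∈ V_ κ.ord} := by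
  intro x hx
  obtain ⟨a, ha, hxa⟩ := h (isClub_Ici ⟨x.rank, ZFSet.mem_vonNeumann.1 hx⟩)
  refine ⟨a.1, ha, fun hax => ?_⟩
  have h1 := ZFSet.rank_lt_of_mem hax
  rw [rank_toZFSet] at h1
  exact h1.not_ge hxa

end Reflection

end SetTheoryLang

theorem mainTheorem1 (κ : Cardinal.{u})
    (hκ : IsLeast {μ : Cardinal.{u} | SetTheoryLang.IsOmegaErdos μ} κ) :
    (V_ κ.ord : ZFSet.{u}) ⊨ SetTheoryLang.ZFC ∧
      SetTheoryLang.ProperClassOfExtremelyReflective {x | x ∈ V_ κ.ord} ∧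
      IsStationary {α : Set.Iio κ.ord |
        SetTheoryLang.IsExtremelyReflectiveIn {x | x ∈ V_ κ.ord} α.1} :=
  have h := SetTheoryLang.isStationary_isExtremelyReflectiveIn hκ
  ⟨SetTheoryLang.model_ZFC_vonNeumann (SetTheoryLang.isInaccessible_of_isLeast hκ),
    SetTheoryLang.properClass_of_isStationary h, h⟩
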